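/- Let $d,s,l\in\mathbb{N}\cup\{0\}$, let $W$ be a nonempty compact Hausdorff space, $T$ a nonempty compact metric space, and $A\subseteq\mathbb{R}^d$ a closed convex set. Let $f:\mathbb{R}^d\times W\to\mathbb{R}$ and $g_i:\mathbb{R}^d\times T\to\mathbb{R}$, $i\in I=\{1,\dots,l\}$, be jointly continuous and differentiable in $x$ with jointly continuous gradients $\nabla_x f$, $\nabla_x g_i$, and let $b:\mathbb{R}^d\to\mathbb{R}^s$ be continuously differentiable. Put $F(x)=\max_{\omega\in W}f(x,\omega)$ and consider the semi-infinite minimax problem $$\min_x F(x)\quad\text{s.t.}\quad g_i(x,t)\le 0\ \ (t\in T,\ i\in I),\quad b(x)=0,\quad x\in A. \tag{1}$$ Problem (1) is of the form: minimise $F(x)$ subject to $G(x)\in K$, $x\in A$, where $G(x)=(g_1(x,\cdot),\dots,g_l(x,\cdot),b(x))$ takes values in $Y=C(T)^l\times\mathbb{R}^s$ and $K=C_-(T)^l\times\{0_s\}$, with $C_-(T)$ the cone of nonpositive continuous functions on $T$. For any problem of this form (with a normed space $Y$ and a closed convex cone $K\subset Y$), a *Lagrange multiplier* at a feasible point $x_*$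 is a $\lambda\in Y^*$ such that $\langle\lambda,y\rangle\le 0$ for all $y\in K$, $\langle\lambda,G(x_*)\rangle=0$, and the directional derivative of $L(\cdot,\lambda)=F(\cdot)+\langle\lambda,G(\cdot)\rangle$ at $x_*$ exists and is $\ge 0$ in every direction $h$ of the contingent cone to $A$ at $x_*$. *Robinson's constraint qualification* (RCQ) holds at $x_*$ if $0\in\operatorname{int}\{G(x_*)+DG(x_*)(A-x_*)-K\}$. A *discrete Lagrange multiplier* of (1) at $x_*$ is a Lagrange multiplier $\lambda=(\mu_1,\dots,\mu_l,\nu)$, acting by $\langle\lambda,(y,z)\rangle=\sum_i\int_T y_i\,d\mu_i+\langle\nu,z\rangle$, in which every $\mu_i$ has the form $\mu_i=\sum_{j=1}^{m_i}\lambda_{ij}\delta(t_{ij})$ with $m_i\le d+1$, $t_{ij}\in T$, $\lambda_{ij}\ge 0$, where $\delta(t)$ is the Dirac measure at $t$. Let $x_*$ be a feasible point of (1), and put $I(x_*)=\{i\in I: \max_{t\in T}g_i(x_*,t)=0\}$ and $T_i(x_*)=\{t\in T: g_i(x_*,t)=0\}$. For given $m_i\in\{1,\dots,d+1\}$ and $t_{ij}\in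 T_i(x_*)$, $j\in\{1,\dots,m_i\}$, $i\in I(x_*)$, the *discretised problem* is $$\min_x F(x)\quad\text{s.t.}\quad g_i(x,t_{ij})\le 0\ \ (j\in\{1,\dots,m_i\},\ i\in I(x_*)),\quad b(x)=0,\quad x\in A. \tag{2}$$ Then: 1. If $x_*$ is a locally optimal solution of (1) at which RCQ holds, then there exists a discrete Lagrange multiplier of (1) at $x_*$. 2. A discrete Lagrange multiplier of (1) exists at $x_*$ if and only if for every $i\in I(x_*)$ one can find $m_i\in\{1,\dots,d+1\}$ and $t_{ij}\in T_i(x_*)$, $j\in\{1,\dots,m_i\}$, such that there exists a Lagrange multiplier of (2) at $x_*$. 3. If $b\equiv 0$, the functions $f(\cdot,\omega)$, $\omega\in W$, and $g_i(\cdot,t)$, $t\in T$, $i\in I$, are convex, and there exists $x_0\in A$ such that $g_i(x_0,t)<0$ for all $t\in T$ and $i\in I$, then the following are equivalent: (a) a discrete Lagrange multiplier of (1) exists at $x_*$; (b) $x_*$ is a globally optimal solution of (1); (c) for every $i\in I(x_*)$ there exist $m_i\in\{1,\dots,d+1\}$ and $t_{ij}\in T_i(x_*)$, $j\in\{1,\dots,m_i\}$,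 such that $x_*$ is a globally optimal solution of (2). -/

import Mathlib

open Set Filter Topology MeasureTheory
open scoped NNReal

namespace ConeMinimax

section General

/-! The cone constrained minimax problem: minimise `F x = max_ω f x ω` subject to
`G x ∈ K`, `x ∈ A`. -/

/-- The max-function `F(x) = max_{ω ∈ W} f(x, ω)`; it is used for a nonempty compact `W` and a
continuous `f`, so that the supremum is a maximum. -/
noncomputable def maxFun {E W : Type*} (f : E → W → ℝ) (x : E) : ℝ := ⨆ ω, f x ω

/-- The feasible region `{x ∈ A | G x ∈ K}`. -/
def feasibleRegion {E Y : Type*} (A : Set E) (G : E → Y) (K : Set Y) : Set E :=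
  {x | x ∈ A ∧ G x ∈ K}

/-- `x` is a locally optimal solution of: minimise `F` over `S`. -/
def IsLocallyOptimal {E : Type*} [TopologicalSpace E] (F : E → ℝ) (S : Set E) (x : E) : Prop :=
  x ∈ S ∧ IsLocalMinOn F S x

/-- `x` is a globally optimal solution of: minimise `F` over `S`. -/
def IsGloballyOptimal {E : Type*} (F : E → ℝ) (S : Set E) (x : E) : Prop :=
  x ∈ S ∧ IsMinOn F S x

variable {E Y : Type*} [NormedAddCommGroup E] [NormedSpace ℝ E]
  [NormedAddCommGroup Y] [NormedSpace ℝ Y]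

/-- The contingent (Bouligand tangent) cone to `C` at `x`. -/
def contingentCone (C : Set E) (x : E) : Set E :=
  {h | ∃ (α : ℕ → ℝ) (v : ℕ → E), (∀ n, 0 < α n) ∧ Tendsto α atTop (𝓝 0) ∧
    Tendsto v atTop (𝓝 h) ∧ ∀ n, x + α n • v n ∈ C}

/-- Robinson's constraint qualification: `0 ∈ int {G(x) + DG(x)(A - x) - K}`. -/
def RobinsonCQ (A : Set E) (G : E → Y) (K : Set Y) (x : E) : Prop :=
  (0 : Y) ∈ interior {y | ∃ a ∈ A, ∃ k ∈ K, y = G x + fderiv ℝ G x (a - x) - k}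

/-- The polar cone `K* = {y* | ⟨y*, y⟩ ≤ 0 for all y ∈ K}`. -/
def polarCone (K : Set Y) : Set (StrongDual ℝ Y) :=
  {l | ∀ y ∈ K, l y ≤ 0}

/-- The (one-sided) directional derivative of `φ` at `x` in the direction `h` exists and
equals `D`. -/
def HasDirDeriv (φ : E → ℝ) (x h : E) (D : ℝ) : Prop :=
  Tendsto (fun α : ℝ => (φ (x + α • h) - φ x) / α) (𝓝[>] 0) (𝓝 D)

/-- `l ∈ Y*` is a Lagrange multiplier at the feasible point `x` of the problem of minimising `F`
subject to `G x ∈ K`, `x ∈ A`: it lies in the polar cone, is complementary to `G x`, and the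
directional derivative at `x` of the Lagrangian `L(·, l) = F + ⟨l, G(·)⟩` is nonnegative in all
directions of the contingent cone to `A`. -/
def IsLagrangeMultiplier (F : E → ℝ) (A : Set E) (G : E → Y) (K : Set Y) (x : E)
    (l : StrongDual ℝ Y) : Prop :=
  x ∈ feasibleRegion A G K ∧ l ∈ polarCone K ∧ l (G x) = 0 ∧
    ∀ h ∈ contingentCone A x, ∃ D : ℝ, HasDirDeriv (fun z => F z + l (G z)) x h D ∧ 0 ≤ D

end General

section SemiInfinite

/-! The semi-infinite problem: `g i x t ≤ 0` for all `t ∈ T` and `i`, `b x = 0`, `x ∈ A`, viewed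
as a cone constrained problem in the space `C(T)^l × ℝ^s`. -/

variable {d s l : ℕ} {T : Type*} [MetricSpace T] [CompactSpace T]

/-- `G(x) = (g₁(x, ·), …, g_l(x, ·), b(x))`. -/
def semiInfMap (g : Fin l → EuclideanSpace ℝ (Fin d) → T → ℝ)
    (hg : ∀ i, Continuous fun p : EuclideanSpace ℝ (Fin d) × T => g i p.1 p.2)
    (b : EuclideanSpace ℝ (Fin d) → EuclideanSpace ℝ (Fin s)) :
    EuclideanSpace ℝ (Fin d) → (Fin l → C(T, ℝ)) × EuclideanSpace ℝ (Fin s) :=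
  fun x => (fun i => ⟨fun t => g i x t, (hg i).comp (by fun_prop : Continuous fun t : T => (x, t))⟩,
    b x)

/-- `K = C₋(T)^l × {0}`. -/
def semiInfCone (l s : ℕ) (T : Type*) [MetricSpace T] [CompactSpace T] :
    Set ((Fin l → C(T, ℝ)) × EuclideanSpace ℝ (Fin s)) :=
  {y | (∀ i t, y.1 i t ≤ 0) ∧ y.2 = 0}

variable [MeasurableSpace T] [BorelSpace T]

/-- The continuous linear functional `y ↦ ∫ y dμ` on `C(T)` given by a finite measure. -/
noncomputable def integralFunctional (μ : FiniteMeasure T) : StrongDual ℝ C(T, ℝ) :=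
  LinearMap.mkContinuous
    { toFun := fun y => ∫ t, y t ∂(μ : Measure T)
      map_add' := fun y z => by
        have h : ∀ u : C(T, ℝ), Integrable (fun t => u t) (μ : Measure T) := fun u =>
          u.continuous.integrable_of_hasCompactSupport (HasCompactSupport.of_compactSpace _)
        simpa using integral_add (h y) (h z)
      map_smul' := fun c y => by simp [integral_const_mul] }
    ((μ : Measure T).real univ)
    (fun y => by
      have := norm_integral_le_of_norm_le_const (μ := (μ : Measure T)) (f := fun t => y t)
        (C := ‖y‖) (Eventually.of_forall fun t => y.norm_coe_le_norm t)
      simpa [mul_comm] using this)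

/-- The functional on `C(T)^l × ℝ^s` given by `(μ₁, …, μ_l, ν)`, namely
`(y, z) ↦ ∑ i, ∫ y i dμ i + ⟨ν, z⟩`. -/
noncomputable def measureFunctional (μ : Fin l → FiniteMeasure T) (ν : EuclideanSpace ℝ (Fin s)) :
    StrongDual ℝ ((Fin l → C(T, ℝ)) × EuclideanSpace ℝ (Fin s)) :=
  (∑ i, (integralFunctional (μ i)).comp
    ((ContinuousLinearMap.proj i).comp
      (ContinuousLinearMap.fst ℝ (Fin l → C(T, ℝ)) (EuclideanSpace ℝ (Fin s))))) +
  (innerSL ℝ ν).comp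
    (ContinuousLinearMap.snd ℝ (Fin l → C(T, ℝ)) (EuclideanSpace ℝ (Fin s)))

theorem measureFunctional_apply (μ : Fin l → FiniteMeasure T) (ν : EuclideanSpace ℝ (Fin s))
    (y : (Fin l → C(T, ℝ)) × EuclideanSpace ℝ (Fin s)) :
    measureFunctional μ ν y = ∑ i, ∫ t, y.1 i t ∂(μ i : Measure T) + inner ℝ ν y.2 := by
  simp [measureFunctional, integralFunctional]

/-- `μ = ∑ j, c j • δ(t j)` with at most `N` points `t j` and coefficients `c j ≥ 0`. -/
def IsDiscreteMeasure (N : ℕ) (μ : Measure T) : Prop :=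
  ∃ m ≤ N, ∃ (t : Fin m → T) (c : Fin m → ℝ≥0), μ = ∑ j, c j • Measure.dirac (t j)

/-- `(μ₁, …, μ_l, ν)` is a discrete Lagrange multiplier at `x` of the semi-infinite problem. -/
def IsDiscreteLagrangeMultiplier (F : EuclideanSpace ℝ (Fin d) → ℝ)
    (A : Set (EuclideanSpace ℝ (Fin d)))
    (g : Fin l → EuclideanSpace ℝ (Fin d) → T → ℝ)
    (hg : ∀ i, Continuous fun p : EuclideanSpace ℝ (Fin d) × T => g i p.1 p.2)
    (b : EuclideanSpace ℝ (Fin d) → EuclideanSpace ℝ (Fin s)) (x : EuclideanSpace ℝ (Fin d))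
    (μ : Fin l → FiniteMeasure T) (ν : EuclideanSpace ℝ (Fin s)) : Prop :=
  IsLagrangeMultiplier F A (semiInfMap g hg b) (semiInfCone l s T) x (measureFunctional μ ν) ∧
    ∀ i, IsDiscreteMeasure (d + 1) (μ i : Measure T)

end SemiInfinite

section Discretised

variable {d s l : ℕ} {T : Type*}

open Classical in
/-- `I(x) = {i | max_{t ∈ T} g_i(x, t) = 0}`. -/
noncomputable def activeIndices (g : Fin l → EuclideanSpace ℝ (Fin d) → T → ℝ)
    (x : EuclideanSpace ℝ (Fin d)) : Finset (Fin l) :=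
  Finset.univ.filter fun i => ⨆ t, g i x t = 0

/-- The constraint mapping `z ↦ ((g_i(z, t_ij))_{ij}, b(z))` of the problem discretised at the
points `t i j`, where `i` ranges over the index set `I` and `j` over `m i` values. -/
def discreteMap (g : Fin l → EuclideanSpace ℝ (Fin d) → T → ℝ)
    (b : EuclideanSpace ℝ (Fin d) → EuclideanSpace ℝ (Fin s)) {I : Finset (Fin l)} {m : I → ℕ}
    (t : ∀ i : I, Fin (m i) → T) :
    EuclideanSpace ℝ (Fin d) → ((Σ i : I, Fin (m i)) → ℝ) × EuclideanSpace ℝ (Fin s) :=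
  fun z => (fun p => g p.1 z (t p.1 p.2), b z)

/-- The cone `(-∞, 0]^J × {0}` of the discretised problem. -/
def discreteCone (J : Type*) (s : ℕ) : Set ((J → ℝ) × EuclideanSpace ℝ (Fin s)) :=
  {y | (∀ p, y.1 p ≤ 0) ∧ y.2 = 0}

/-- A choice, for every `i ∈ I(x)`, of `m i ∈ {1, …, d + 1}` and of points `t i j` in
`T_i(x) = {t | g_i(x, t) = 0}`, `j ∈ {1, …, m i}`. -/
def IsActiveDiscretisation (g : Fin l → EuclideanSpace ℝ (Fin d) → T → ℝ)
    (x : EuclideanSpace ℝ (Fin d)) (m : activeIndices g x → ℕ)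
    (t : ∀ i : activeIndices g x, Fin (m i) → T) : Prop :=
  (∀ i, 1 ≤ m i ∧ m i ≤ d + 1) ∧ ∀ (i : activeIndices g x) (j : Fin (m i)), g i x (t i j) = 0

end Discretised

end ConeMinimax

/-! At a local minimum the linearised system has no strict solution in `A`: no `a ∈ A` with `Db(x)(a
- x) = 0` makes every `f(x, ω) - F(x) + ∇f(a - x)` and every `g_i(x, t) + ∇g_i(a - x)` negative.
Otherwise one could leave `x` in the direction `a - x`, correct the path onto `b = 0` by the inverse
function theorem, remain feasible and decrease `F` (`exists_nonneg_of_isLocallyOptimal`). The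
correction stays in `A` because `exists_regular_point` finds points around which `A` has room in the
directions of a right inverse of `Db(x)`.

Insolvability is dualised by `exists_multipliers_of_forall_exists`. Sion's minimax theorem is
applied to the compact convex hull of the pairs (value, gradient), times a ball of multipliers `ν`;
the ball suffices because regularity makes the penalty exact. This gives finitely many weights.
Testing at `a = x` shows that only active `ω` and `t` carry weight, and the strict solution supplied
by RCQ shows that the objective has positive total weight, so one may normalise by it.
Carathéodory's theorem in the `d`-dimensional dual then leaves at most `d + 1` atoms for each `i`.
Danskin's theorem turns the resulting inequality into one for the directional derivative of the
Lagrangian.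

For the discretised problems, both multipliers define the same Lagrangian, up to deleting or padding
atoms of weight zero. In the convex case the Lagrangian is convex, so a multiplier forces global
optimality; Slater's condition supplies the strict solution for the converse. Discretising enlarges
the feasible region, so optimality for (2) passes back to (1). -/

namespace ConeMinimax

/-! ### First-order expansions uniform over a compact parameter space. -/

section UniformTaylor

/-- The tube lemma for an arbitrary filter: a property that holds locally near every point of a
compact space holds eventually for all points. -/
theorem eventually_forall_of_compactSpace {X S : Type*} [TopologicalSpace S] [CompactSpace S]
    {l : Filter X} {P : X → S → Prop} (h : ∀ s, ∀ᶠ p in l ×ˢ 𝓝 s, P p.1 p.2) :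
    ∀ᶠ x in l, ∀ s, P x s := by
  have := isCompact_univ.mem_prod_nhdsSet_of_forall (K := (univ : Set S)) (l := l)
    (s := {p : X × S | P p.1 p.2}) fun s _ => h s
  rw [nhdsSet_univ, mem_prod_top] at this
  exact this

variable {E S : Type*} [NormedAddCommGroup E] [NormedSpace ℝ E] [TopologicalSpace S]
  [CompactSpace S]

/-- Compactness of `S` gives one ball around `x₀` on which all gradients are `ε`-close to their
values at `x₀`; the mean value inequality on that ball does the rest. -/
theorem eventually_uniform_taylor {φ : E → S → ℝ} (hd : ∀ s, Differentiable ℝ fun x => φ x s)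
    (hD : Continuous fun p : E × S => fderiv ℝ (fun x => φ x p.2) p.1) (x₀ : E) {ε : ℝ}
    (hε : 0 < ε) :
    ∀ᶠ x in 𝓝 x₀, ∀ s,
      |φ x s - φ x₀ s - fderiv ℝ (fun x => φ x s) x₀ (x - x₀)| ≤ ε * ‖x - x₀‖ := by
  have key : ∀ᶠ z in 𝓝 x₀, ∀ s,
      ‖fderiv ℝ (fun x => φ x s) z - fderiv ℝ (fun x => φ x s) x₀‖ < ε := by
    refine eventually_forall_of_compactSpace
      (P := fun z s => ‖fderiv ℝ (fun x => φ x s) z - fderiv ℝ (fun x => φ x s) x₀‖ < ε)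
      fun s => ?_
    rw [← nhds_prod_eq]
    have hc : Continuous fun p : E × S =>
        ‖fderiv ℝ (fun x => φ x p.2) p.1 - fderiv ℝ (fun x => φ x p.2) x₀‖ :=
      (hD.sub (hD.comp (by fun_prop : Continuous fun p : E × S => (x₀, p.2)))).norm
    exact hc.continuousAt.eventually_lt continuousAt_const (by simpa using hε)
  obtain ⟨δ, hδ, hball⟩ := Metric.eventually_nhds_iff_ball.1 key
  filter_upwards [Metric.ball_mem_nhds x₀ hδ] with x hx s
  have := (convex_ball x₀ δ).norm_image_sub_le_of_norm_fderiv_le' (𝕜 := ℝ)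
    (f := fun x => φ x s) (φ := fderiv ℝ (fun x => φ x s) x₀) (C := ε)
    (fun z _ => (hd s) z) (fun z hz => (hball z hz s).le) (Metric.mem_ball_self hδ) hx
  simpa [Real.norm_eq_abs] using this

/-- A `C¹` family of constraints, nonpositive at `x₀` and with derivative less than `r` in the
direction `h` for the active parameters, is eventually less than `r τ` along every curve leaving
`x₀` in the direction `h`. -/
theorem eventually_forall_lt_along_curve {φ : E → S → ℝ}
    (hφ : Continuous fun p : E × S => φ p.1 p.2) (hd : ∀ s, Differentiable ℝ fun x => φ x s)
    (hD : Continuous fun p : E × S => fderiv ℝ (fun x => φ x p.2) p.1) {x₀ h : E} {c : ℝ → E}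
    (hc : Tendsto (fun τ : ℝ => τ⁻¹ • (c τ - x₀)) (𝓝[>] 0) (𝓝 h)) {r : ℝ}
    (hle : ∀ s, φ x₀ s ≤ 0) (hlt : ∀ s, φ x₀ s = 0 → fderiv ℝ (fun x => φ x s) x₀ h < r) :
    ∀ᶠ τ in 𝓝[>] (0 : ℝ), ∀ s, φ (c τ) s < r * τ := by
  have hid : Tendsto (fun τ : ℝ => τ) (𝓝[>] 0) (𝓝 0) := tendsto_id.mono_left inf_le_left
  have hpos : ∀ᶠ τ in 𝓝[>] (0 : ℝ), 0 < τ := eventually_mem_nhdsWithin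
  have hc0 : Tendsto c (𝓝[>] 0) (𝓝 x₀) := by
    have h1 : Tendsto (fun τ : ℝ => x₀ + τ • (τ⁻¹ • (c τ - x₀))) (𝓝[>] 0) (𝓝 (x₀ + (0 : ℝ) • h)) :=
      tendsto_const_nhds.add (hid.smul hc)
    rw [zero_smul, add_zero] at h1
    refine h1.congr' ?_
    filter_upwards [hpos] with τ hτ
    rw [smul_inv_smul₀ hτ.ne']; abel
  refine eventually_forall_of_compactSpace (P := fun τ s => φ (c τ) s < r * τ) fun s => ?_
  -- Near an inactive parameter, `φ` stays below a negative number while `r * τ → 0`. Near an active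
  -- one, the first-order term decides after division by `τ`.
  rcases (hle s).lt_or_eq with hs | hs
  · have h1 : Tendsto (fun p : ℝ × S => φ (c p.1) p.2) (𝓝[>] 0 ×ˢ 𝓝 s) (𝓝 (φ x₀ s)) :=
      (hφ.tendsto (x₀, s)).comp (by
        rw [nhds_prod_eq]; exact (hc0.comp tendsto_fst).prodMk tendsto_snd)
    have h2 : Tendsto (fun p : ℝ × S => r * p.1) (𝓝[>] 0 ×ˢ 𝓝 s) (𝓝 (r * 0)) :=
      (hid.comp tendsto_fst).const_mul r
    exact h1.eventually_lt h2 (by simpa using hs)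
  · obtain ⟨ε, hε, hεr⟩ : ∃ ε > 0, fderiv ℝ (fun x => φ x s) x₀ h + ε * ‖h‖ < r := by
      have hlt := hlt s hs
      have hp : 0 < ‖h‖ + 1 := by positivity
      -- Dividing by `‖h‖ + 1` rather than `‖h‖` covers `h = 0` and keeps the inequality strict.
      refine ⟨(r - fderiv ℝ (fun x => φ x s) x₀ h) / (‖h‖ + 1), div_pos (sub_pos.2 hlt) hp, ?_⟩
      have : (r - fderiv ℝ (fun x => φ x s) x₀ h) / (‖h‖ + 1) * ‖h‖
          < r - fderiv ℝ (fun x => φ x s) x₀ h := by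
        rw [div_mul_eq_mul_div, div_lt_iff₀ hp]
        nlinarith [norm_nonneg h]
      linarith
    have hq : Tendsto (fun p : ℝ × S => p.1⁻¹ • (c p.1 - x₀)) (𝓝[>] 0 ×ˢ 𝓝 s) (𝓝 h) :=
      hc.comp tendsto_fst
    have hDs : Tendsto (fun p : ℝ × S => fderiv ℝ (fun x => φ x p.2) x₀)
        (𝓝[>] 0 ×ˢ 𝓝 s) (𝓝 (fderiv ℝ (fun x => φ x s) x₀)) :=
      ((hD.comp (by fun_prop : Continuous fun s : S => (x₀, s))).tendsto s).comp tendsto_snd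
    have hb : Tendsto (fun p : ℝ × S => fderiv ℝ (fun x => φ x p.2) x₀ (p.1⁻¹ • (c p.1 - x₀))
        + ε * ‖p.1⁻¹ • (c p.1 - x₀)‖) (𝓝[>] 0 ×ˢ 𝓝 s)
        (𝓝 (fderiv ℝ (fun x => φ x s) x₀ h + ε * ‖h‖)) :=
      (((isBoundedBilinearMap_apply (𝕜 := ℝ) (E := E) (F := ℝ)).continuous.tendsto
        (fderiv ℝ (fun x => φ x s) x₀, h)).comp (hDs.prodMk_nhds hq)).add (hq.norm.const_mul ε)
    have ht := (hc0.eventually (eventually_uniform_taylor hd hD x₀ hε)).and hpos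
    filter_upwards [hb.eventually_lt tendsto_const_nhds hεr,
      (tendsto_fst (f := 𝓝[>] (0 : ℝ)) (g := 𝓝 s)).eventually ht] with p hp hp'
    obtain ⟨hT, hτ⟩ := hp'
    have hT := (abs_le.1 (hT p.2)).2
    have he : c p.1 - x₀ = p.1 • (p.1⁻¹ • (c p.1 - x₀)) := (smul_inv_smul₀ hτ.ne' _).symm
    have hn : ‖c p.1 - x₀‖ = p.1 * ‖p.1⁻¹ • (c p.1 - x₀)‖ := by
      conv_lhs => rw [he, norm_smul, Real.norm_of_nonneg hτ.le]
    have hm : fderiv ℝ (fun x => φ x p.2) x₀ (c p.1 - x₀)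
        = p.1 * fderiv ℝ (fun x => φ x p.2) x₀ (p.1⁻¹ • (c p.1 - x₀)) := by
      conv_lhs => rw [he, map_smul, smul_eq_mul]
    rw [hn, hm] at hT
    have := hle p.2
    nlinarith [mul_lt_mul_of_pos_left hp hτ]

end UniformTaylor

/-! ### The max-function and its directional derivative. -/

section MaxFunction

variable {E W : Type*} [TopologicalSpace W] [CompactSpace W]

theorem bddAbove_range_of_continuous [TopologicalSpace E] {f : E → W → ℝ}
    (hf : Continuous fun p : E × W => f p.1 p.2) (x : E) : BddAbove (range (f x)) :=
  (isCompact_range (hf.comp (by fun_prop : Continuous fun ω : W => (x, ω)))).bddAbove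

theorem le_maxFun [TopologicalSpace E] {f : E → W → ℝ}
    (hf : Continuous fun p : E × W => f p.1 p.2) (x : E) (ω : W) : f x ω ≤ maxFun f x :=
  le_ciSup (bddAbove_range_of_continuous hf x) ω

theorem exists_eq_maxFun [TopologicalSpace E] [Nonempty W] {f : E → W → ℝ}
    (hf : Continuous fun p : E × W => f p.1 p.2) (x : E) : ∃ ω, f x ω = maxFun f x := by
  have hc : Continuous (f x) := hf.comp (by fun_prop : Continuous fun ω : W => (x, ω))
  obtain ⟨ω, -, hω⟩ := isCompact_univ.exists_isMaxOn univ_nonempty hc.continuousOn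
  exact ⟨ω, le_antisymm (le_maxFun hf x ω) (ciSup_le fun ω' => hω (mem_univ ω'))⟩

/-- Danskin's theorem: the max-function of a `C¹` family is directionally differentiable, and its
directional derivative dominates the derivatives of the active functions. -/
theorem exists_hasDirDeriv_maxFun [NormedAddCommGroup E] [NormedSpace ℝ E] [Nonempty W]
    {f : E → W → ℝ} (hf : Continuous fun p : E × W => f p.1 p.2)
    (hd : ∀ ω, Differentiable ℝ fun x => f x ω)
    (hD : Continuous fun p : E × W => fderiv ℝ (fun x => f x p.2) p.1) (x h : E) :
    ∃ D, HasDirDeriv (maxFun f) x h D ∧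
      ∀ ω, f x ω = maxFun f x → fderiv ℝ (fun x => f x ω) x h ≤ D := by
  have hc : Continuous (f x) := hf.comp (by fun_prop : Continuous fun ω : W => (x, ω))
  have hcl : IsClosed {ω | f x ω = maxFun f x} := isClosed_eq hc continuous_const
  have hcD : Continuous fun ω => fderiv ℝ (fun x => f x ω) x h :=
    (hD.comp (by fun_prop : Continuous fun ω : W => (x, ω))).clm_apply continuous_const
  obtain ⟨ω₀, hω₀, hmax⟩ := hcl.isCompact.exists_isMaxOn (exists_eq_maxFun hf x) hcD.continuousOn
  refine ⟨fderiv ℝ (fun x => f x ω₀) x h, ?_, fun ω hω => hmax hω⟩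
  have hpos : ∀ᶠ τ in 𝓝[>] (0 : ℝ), 0 < τ := eventually_mem_nhdsWithin
  have hcurve : Tendsto (fun τ : ℝ => τ⁻¹ • ((x + τ • h) - x)) (𝓝[>] 0) (𝓝 h) := by
    refine tendsto_const_nhds.congr' ?_
    filter_upwards [hpos] with τ hτ
    rw [add_sub_cancel_left, inv_smul_smul₀ hτ.ne']
  refine tendsto_order.2 ⟨fun r hr => ?_, fun r hr => ?_⟩
  -- Lower bound: `F` dominates the single function `f · ω₀`, with equality at `x`.
  · have hdir : HasDerivAt (fun τ : ℝ => f (x + τ • h) ω₀) (fderiv ℝ (fun x => f x ω₀) x h) 0 := by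
      have h1 : HasDerivAt (fun τ : ℝ => x + τ • h) h 0 := by
        simpa using ((hasDerivAt_id (0 : ℝ)).smul_const h).const_add x
      have h2 : HasFDerivAt (fun x => f x ω₀) (fderiv ℝ (fun x => f x ω₀) x)
          (x + (0 : ℝ) • h) := by
        simpa using (hd ω₀ x).hasFDerivAt
      exact h2.comp_hasDerivAt (0 : ℝ) h1
    have hs := hdir.tendsto_slope_zero_right
    filter_upwards [hs.eventually (lt_mem_nhds hr), hpos] with τ hτ hτ0
    refine hτ.trans_le ?_
    rw [smul_eq_mul, inv_mul_eq_div]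
    gcongr
    · simpa using le_maxFun hf _ _
    · simpa using hω₀.ge
  -- Upper bound: after subtracting `F(x)` the family is nonpositive at `x`, and its active
  -- parameters are the maximisers. The intermediate `r'` absorbs the loss of strictness in the
  -- supremum.
  · obtain ⟨r', hr', hr'r⟩ := exists_between hr
    have := eventually_forall_lt_along_curve (φ := fun z ω => f z ω - maxFun f x)
      (hf.sub continuous_const) (fun ω => (hd ω).sub_const _)
      (by simpa only [fderiv_sub_const] using hD) hcurve (r := r')
      (fun ω => sub_nonpos.2 (le_maxFun hf x ω))
      (fun ω hω => by
        rw [fderiv_sub_const]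
        exact (hmax (show f x ω = maxFun f x from sub_eq_zero.1 hω)).trans_lt hr')
    filter_upwards [this, hpos] with τ hτ hτ0
    refine lt_of_le_of_lt ?_ hr'r
    rw [div_le_iff₀ hτ0, sub_le_iff_le_add]
    exact ciSup_le fun ω => by linarith [hτ ω]

end MaxFunction

/-! ### Carathéodory's theorem and compactness of convex hulls. -/

section Caratheodory

variable {V : Type*} [NormedAddCommGroup V] [NormedSpace ℝ V] [FiniteDimensional ℝ V]

/-- Carathéodory's theorem for convex hulls, with the points indexed by `Fin m`. -/
theorem exists_fin_of_mem_convexHull {Z : Set V} {x : V} (hx : x ∈ convexHull ℝ Z) :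
    ∃ m ≤ Module.finrank ℝ V + 1, ∃ (z : Fin m → V) (w : Fin m → ℝ),
      (∀ j, z j ∈ Z) ∧ w ∈ stdSimplex ℝ (Fin m) ∧ ∑ j, w j • z j = x := by
  obtain ⟨ι, _, z, w, hz, hind, hw, hw1, hx⟩ := eq_pos_convex_span_of_mem_convexHull hx
  have hcard : Fintype.card ι ≤ Module.finrank ℝ V + 1 :=
    hind.card_le_finrank_succ.trans (by gcongr; exact Submodule.finrank_le _)
  let e := (Fintype.equivFin ι).symm
  refine ⟨Fintype.card ι, hcard, z ∘ e, w ∘ e, fun j => hz (mem_range_self _),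
    ⟨fun j => (hw _).le, ?_⟩, ?_⟩
  · rw [← hw1]; exact e.sum_comp w
  · rw [← hx]; exact e.sum_comp fun i => w i • z i

/-- The convex hull of a compact set in a finite-dimensional space is compact. -/
theorem isCompact_convexHull_of_isCompact {Z : Set V} (hZ : IsCompact Z) :
    IsCompact (convexHull ℝ Z) := by
  -- Bounding the number of points makes the hull a finite union of continuous images of compact
  -- sets.
  have key : convexHull ℝ Z = ⋃ m ∈ Finset.range (Module.finrank ℝ V + 2),
      (fun p : (Fin m → V) × (Fin m → ℝ) => ∑ j, p.2 j • p.1 j) ''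
        ((univ.pi fun _ => Z) ×ˢ stdSimplex ℝ (Fin m)) := by
    apply Subset.antisymm
    · intro x hx
      obtain ⟨m, hm, z, w, hz, hw, rfl⟩ := exists_fin_of_mem_convexHull hx
      simp only [mem_iUnion]
      exact ⟨m, Finset.mem_range.2 (by omega), (z, w), ⟨fun j _ => hz j, hw⟩, rfl⟩
    · simp only [iUnion_subset_iff]
      rintro m - _ ⟨⟨z, w⟩, ⟨hz, hw⟩, rfl⟩
      exact (convex_convexHull ℝ Z).sum_mem (fun j _ => hw.1 j) hw.2
        fun j _ => subset_convexHull ℝ Z (hz j (mem_univ j))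
  rw [key]
  refine (Finset.range _).isCompact_biUnion fun m _ => ?_
  exact ((isCompact_univ_pi fun _ => hZ).prod (isCompact_stdSimplex ℝ _)).image (by fun_prop)

/-- Carathéodory's theorem for cones, in the crude form with `finrank + 1` vectors. -/
theorem exists_fin_of_sum_smul {ι T : Type*} {J : Finset ι} {w : ι → ℝ} (hw : ∀ k ∈ J, 0 ≤ w k)
    (τ : ι → T) (v : T → V) (P : T → Prop) (hP : ∀ k ∈ J, w k ≠ 0 → P (τ k)) :
    ∃ m ≤ Module.finrank ℝ V + 1, ∃ (t : Fin m → T) (c : Fin m → ℝ≥0),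
      (∀ j, P (t j)) ∧ ∑ j, (c j : ℝ) • v (t j) = ∑ k ∈ J, w k • v (τ k) := by
  classical
  rcases (Finset.sum_nonneg hw).eq_or_lt' with h0 | hpos
  · refine ⟨0, zero_le, Fin.elim0, Fin.elim0, fun j => j.elim0, ?_⟩
    rw [Finset.sum_eq_zero_iff_of_nonneg hw] at h0
    rw [Fin.sum_univ_zero, Finset.sum_eq_zero fun k hk => by rw [h0 k hk, zero_smul]]
  · set Λ := ∑ k ∈ J, w k with hΛ
    -- `P` is known only where the weight is nonzero; discarding the other indices does not change
    -- the centre of mass.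
    let J' := J.filter fun k => w k ≠ 0
    have hmem : J'.centerMass w (fun k => v (τ k)) ∈ convexHull ℝ (v '' {t | P t}) := by
      refine J'.centerMass_mem_convexHull (fun k hk => hw k (Finset.mem_filter.1 hk).1) ?_
        fun k hk => ⟨τ k, hP k (Finset.mem_filter.1 hk).1 (Finset.mem_filter.1 hk).2, rfl⟩
      rwa [Finset.sum_filter_ne_zero]
    obtain ⟨m, hm, z, c, hz, hc, hsum⟩ := exists_fin_of_mem_convexHull hmem
    choose t ht htz using hz
    refine ⟨m, hm, t, fun j => ⟨Λ * c j, mul_nonneg hpos.le (hc.1 j)⟩, ht, ?_⟩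
    have : ∑ j, (Λ * c j) • v (t j) = Λ • J'.centerMass w fun k => v (τ k) := by
      rw [← hsum, Finset.smul_sum]
      exact Finset.sum_congr rfl fun j _ => by rw [htz, mul_smul]
    refine this.trans ?_
    rw [show J'.centerMass w (fun k => v (τ k)) = J.centerMass w fun k => v (τ k) from
      Finset.centerMass_filter_ne_zero _, Finset.centerMass, ← hΛ, smul_inv_smul₀ hpos.ne']

end Caratheodory

/-! ### A theorem of the alternative by minimax. -/

section Alternative

variable {E S Y : Type*} [NormedAddCommGroup E] [NormedSpace ℝ E]
  [TopologicalSpace S] [CompactSpace S] [NormedAddCommGroup Y] [InnerProductSpace ℝ Y]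

/-- A minimax theorem for a convex compact set `Q` of affine functionals. -/
theorem exists_forall_nonneg_of_forall_exists {V : Type*} [NormedAddCommGroup V] [NormedSpace ℝ V]
    {Q : Set V} (hQ : IsCompact Q) (hQc : Convex ℝ Q) (hQne : Q.Nonempty)
    {A : Set E} (hA : Convex ℝ A) {Φ : V → E → ℝ}
    (hΦq : ∀ a, ∃ α : V →L[ℝ] ℝ, ∀ q, Φ q a = α q)
    (hΦa : ∀ q, ∃ (c : ℝ) (β : E →L[ℝ] ℝ), ∀ a, Φ q a = c + β a)
    (h : ∀ a ∈ A, ∃ q ∈ Q, 0 ≤ Φ q a) : ∃ q ∈ Q, ∀ a ∈ A, 0 ≤ Φ q a := by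
  by_contra! hneg
  have hcq : ∀ a, Continuous fun q => Φ q a := fun a => by
    obtain ⟨α, hα⟩ := hΦq a
    simpa only [hα] using α.continuous
  have hca : ∀ q, Continuous fun a => Φ q a := fun q => by
    obtain ⟨c, β, hβ⟩ := hΦa q
    simpa only [hβ] using β.continuous.const_add c
  have hlq : ∀ (a : E) (u v : V) (r t : ℝ), Φ (r • u + t • v) a = r * Φ u a + t * Φ v a := by
    intro a u v r t
    obtain ⟨α, hα⟩ := hΦq a
    simp only [hα, map_add, map_smul, smul_eq_mul]
  have hla : ∀ (q : V) (u v : E) (r t : ℝ), r + t = 1 →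
      Φ q (r • u + t • v) = r * Φ q u + t * Φ q v := by
    intro q u v r t hrt
    obtain ⟨c, β, hβ⟩ := hΦa q
    simp only [hβ, map_add, map_smul, smul_eq_mul]
    linear_combination (-c) * hrt
  -- If every `q` fails at some `a q`, compactness leaves finitely many such points, and Sion's
  -- theorem merges them into one `a₀` at which all `q` fail.
  choose! a ha hlt using hneg
  obtain ⟨F, hFQ, hF⟩ := hQ.elim_nhds_subcover (fun q => {q' | Φ q' (a q) < 0})
    fun q hq => (hcq (a q)).continuousAt.eventually_lt continuousAt_const (hlt q hq)
  obtain ⟨a₀, ha₀, h₀⟩ := Sion.exists_lt_iInf_of_lt_iInf_of_finite (X := Q) (Y := A)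
    (f := fun q x => -Φ q x) (t := (0 : ℝ)) hQne hQ
    (fun x _ => (hcq x).neg.lowerSemicontinuous.lowerSemicontinuousOn _)
    (fun x _ => ConvexOn.quasiconvexOn ⟨hQc, fun u _ v _ r t _ _ _ => by
      simp only [hlq, smul_eq_mul]; linarith⟩) hA
    (fun q _ => (hca q).neg.upperSemicontinuous.upperSemicontinuousOn _)
    (fun q _ => ConcaveOn.quasiconcaveOn ⟨hA, fun u _ v _ r t _ _ hrt => by
      simp only [hla q u v r t hrt, smul_eq_mul]; linarith⟩) hQc
    (s := a '' F) (F.finite_toSet.image a) (by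
      rintro _ ⟨q, hq, rfl⟩; exact ha q (hFQ q hq))
    (fun q hq => by
      obtain ⟨q', hq', hlt'⟩ := mem_iUnion₂.1 (hF hq)
      exact ⟨a q', ⟨q', hq', rfl⟩, neg_pos.2 hlt'⟩)
  obtain ⟨q, hq, hq0⟩ := h a₀ ha₀
  linarith [h₀ q hq]

/-- A theorem of the alternative for an infinite system of affine inequalities with a linear
equality constraint that is regular relative to the convex set `A`. -/
theorem exists_multipliers_of_forall_exists [FiniteDimensional ℝ E] [FiniteDimensional ℝ Y]
    {ψ : S → ℝ} (hψ : Continuous ψ) {D : S → StrongDual ℝ E} (hD : Continuous D) {A : Set E}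
    (hA : Convex ℝ A) (B : E →L[ℝ] Y) (x₀ : E)
    (hreg : ∃ δ > 0, ∃ R, ∀ u, ‖u‖ ≤ δ → ∃ a ∈ A, B (a - x₀) = u ∧ ‖a - x₀‖ ≤ R)
    (h : ∀ a ∈ A, B (a - x₀) = 0 → ∃ s, 0 ≤ ψ s + D s (a - x₀)) :
    ∃ (ι : Type) (_ : Fintype ι) (w : ι → ℝ) (s : ι → S) (ν : Y), w ∈ stdSimplex ℝ ι ∧
      ∀ a ∈ A, 0 ≤ ∑ k, w k * (ψ (s k) + D (s k) (a - x₀)) + inner ℝ ν (B (a - x₀)) := by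
  obtain ⟨δ, hδ, R, hreg⟩ := hreg
  have hS : Nonempty S := by
    obtain ⟨a, ha, ha0, -⟩ := hreg 0 (by simpa using hδ.le)
    exact (h a ha ha0).nonempty
  obtain ⟨K, hK⟩ : ∃ K, ∀ s, ψ s + ‖D s‖ * R ≤ K := by
    have hc : Continuous fun s => ψ s + ‖D s‖ * R := by fun_prop
    obtain ⟨K, hK⟩ := (isCompact_range hc).bddAbove
    exact ⟨K, fun s => hK (mem_range_self s)⟩
  -- The penalty radius: chosen so that `M * δ = |K|` bounds the affine values at the correcting
  -- points supplied by `hreg`.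
  set M := |K| / δ with hM
  have hM0 : 0 ≤ M := by positivity
  set Z := range fun s => (ψ s, D s) with hZ
  have hZc : IsCompact Z := isCompact_range (hψ.prodMk hD)
  let Φ : (ℝ × StrongDual ℝ E) × Y → E → ℝ := fun q a =>
    q.1.1 + q.1.2 (a - x₀) + inner ℝ q.2 (B (a - x₀))
  obtain ⟨⟨q, ν⟩, ⟨hq, -⟩, hqν⟩ := exists_forall_nonneg_of_forall_exists (Φ := Φ)
    (Q := convexHull ℝ Z ×ˢ Metric.closedBall (0 : Y) M)
    ((isCompact_convexHull_of_isCompact hZc).prod (isCompact_closedBall 0 M))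
    ((convex_convexHull ℝ Z).prod (convex_closedBall 0 M))
    ((range_nonempty _).convexHull.prod (Metric.nonempty_closedBall.2 hM0)) hA
    (fun a => ⟨(ContinuousLinearMap.fst ℝ ℝ _).comp (ContinuousLinearMap.fst ℝ _ _) +
      (ContinuousLinearMap.apply ℝ ℝ (a - x₀)).comp
        ((ContinuousLinearMap.snd ℝ ℝ _).comp (ContinuousLinearMap.fst ℝ _ _)) +
      (innerSL ℝ (B (a - x₀))).comp (ContinuousLinearMap.snd ℝ _ _),
      fun q => by simp [Φ, real_inner_comm, inner_sub_right]⟩)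
    (fun q => ⟨q.1.1 - q.1.2 x₀ - inner ℝ q.2 (B x₀), q.1.2 + (innerSL ℝ q.2).comp B,
      fun a => by simp only [Φ, map_sub, inner_sub_right, add_apply,
        ContinuousLinearMap.comp_apply, innerSL_apply_apply]; ring⟩)
    (fun a ha => by
      rcases eq_or_ne (B (a - x₀)) 0 with hz | hz
      · obtain ⟨s, hs⟩ := h a ha hz
        exact ⟨((ψ s, D s), 0), ⟨subset_convexHull ℝ Z ⟨s, rfl⟩, by simpa using hM0⟩,
          by simpa [Φ] using hs⟩
      · have hn : 0 < ‖B (a - x₀)‖ := norm_pos_iff.2 hz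
        set z := B (a - x₀) with hzdef
        -- `a₁` violates the equality in the opposite direction, so the combination of `a` and `a₁`
        -- with weights proportional to `δ` and `‖z‖` satisfies it and `h` applies there.
        obtain ⟨a₁, ha₁, hu, hR⟩ := hreg (-(δ / ‖z‖) • z) (by
          rw [norm_smul, norm_neg, Real.norm_of_nonneg (by positivity), div_mul_cancel₀ _ hn.ne'])
        have hne : ‖z‖ + δ ≠ 0 := by positivity
        have hθ : δ / (‖z‖ + δ) + ‖z‖ / (‖z‖ + δ) = 1 := by field_simp; ring
        have hsub : (δ / (‖z‖ + δ)) • a + (‖z‖ / (‖z‖ + δ)) • a₁ - x₀ =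
            (δ / (‖z‖ + δ)) • (a - x₀) + (‖z‖ / (‖z‖ + δ)) • (a₁ - x₀) := by
          conv_lhs => rw [← one_smul ℝ x₀, ← hθ]
          module
        obtain ⟨s, hs⟩ := h _ (hA ha ha₁ (by positivity) (by positivity) hθ) (by
          rw [hsub, map_add, map_smul, map_smul, hu, ← hzdef, smul_smul, ← add_smul]
          convert! zero_smul ℝ z
          field_simp; ring)
        -- Taking `ν` of norm `M` along `z` adds `M * ‖z‖`, which compensates for the share of `a₁`
        -- in the combination.
        refine ⟨((ψ s, D s), (M / ‖z‖) • z), ⟨subset_convexHull ℝ Z ⟨s, rfl⟩, ?_⟩, ?_⟩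
        · rw [mem_closedBall_zero_iff, norm_smul, Real.norm_of_nonneg (by positivity),
            div_mul_cancel₀ _ hn.ne']
        · have h1 : ψ s + D s (a₁ - x₀) ≤ |K| := by
            have h2 : D s (a₁ - x₀) ≤ ‖D s‖ * R :=
              (le_abs_self _).trans ((D s).le_opNorm_of_le hR)
            linarith [hK s, le_abs_self K]
          have h3 : inner ℝ ((M / ‖z‖) • z) z = M * ‖z‖ := by
            rw [real_inner_smul_left, real_inner_self_eq_norm_sq]; field_simp
          simp only [Φ, ← hzdef, h3]
          rw [hsub, map_add, map_smul, map_smul, smul_eq_mul, smul_eq_mul] at hs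
          have h4 : 0 ≤ δ / (‖z‖ + δ) * (ψ s + D s (a - x₀)) + ‖z‖ / (‖z‖ + δ) * |K| := by
            have := mul_le_mul_of_nonneg_left h1 (show 0 ≤ ‖z‖ / (‖z‖ + δ) by positivity)
            linear_combination hs + this + (-ψ s) * hθ
          have h5 : δ / (‖z‖ + δ) * (ψ s + D s (a - x₀)) + ‖z‖ / (‖z‖ + δ) * |K| =
              δ / (‖z‖ + δ) * (ψ s + D s (a - x₀) + M * ‖z‖) := by
            rw [hM]; field_simp
          rw [h5] at h4
          exact nonneg_of_mul_nonneg_right h4 (by positivity))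
  obtain ⟨ι, _, w, z, hw, hw1, hz, hsum⟩ := mem_convexHull_iff_exists_fintype.1 hq
  choose s hs using hz
  refine ⟨ι, inferInstance, w, s, ν, ⟨hw, hw1⟩, fun a ha => ?_⟩
  have h1 : q.1 = ∑ k, w k * ψ (s k) := by
    rw [← show ∑ i, w i • z i = q from hsum]; simp [← hs, Prod.fst_sum]
  have h2 : q.2 (a - x₀) = ∑ k, w k * D (s k) (a - x₀) := by
    rw [← show ∑ i, w i • z i = q from hsum]; simp [← hs, Prod.snd_sum]
  have := hqν a ha
  simp only [Φ, h1, h2] at this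
  simpa only [mul_add, Finset.sum_add_distrib] using this

end Alternative

/-! ### Derivative of the constraint map and the meaning of RCQ. -/

section Differentiability

variable {d s l : ℕ} {T : Type*} [MetricSpace T] [CompactSpace T]

/-- The constraint mapping of the semi-infinite problem is Fréchet differentiable, and its
derivative is computed pointwise. -/
theorem exists_hasFDerivAt_semiInfMap {g : Fin l → EuclideanSpace ℝ (Fin d) → T → ℝ}
    (hg : ∀ i, Continuous fun p : EuclideanSpace ℝ (Fin d) × T => g i p.1 p.2)
    (hg_diff : ∀ i t, Differentiable ℝ fun x => g i x t)
    (hg_grad : ∀ i, Continuous fun p : EuclideanSpace ℝ (Fin d) × T =>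
      fderiv ℝ (fun x => g i x p.2) p.1)
    {b : EuclideanSpace ℝ (Fin d) → EuclideanSpace ℝ (Fin s)} (hb : Differentiable ℝ b)
    (x : EuclideanSpace ℝ (Fin d)) :
    ∃ L : EuclideanSpace ℝ (Fin d) →L[ℝ] (Fin l → C(T, ℝ)) × EuclideanSpace ℝ (Fin s),
      HasFDerivAt (semiInfMap g hg b) L x ∧
        ∀ h, (∀ i t, (L h).1 i t = fderiv ℝ (fun x => g i x t) x h) ∧ (L h).2 = fderiv ℝ b x h := by
  have hcont : ∀ i, Continuous fun t => fderiv ℝ (fun x => g i x t) x := fun i =>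
    (hg_grad i).comp (by fun_prop : Continuous fun t : T => (x, t))
  let D : Fin l → EuclideanSpace ℝ (Fin d) →ₗ[ℝ] C(T, ℝ) := fun i =>
    { toFun := fun h => ⟨fun t => fderiv ℝ (fun x => g i x t) x h,
        (hcont i).clm_apply continuous_const⟩
      map_add' := fun u v => by ext t; simp
      map_smul' := fun r u => by ext t; simp }
  refine ⟨(ContinuousLinearMap.pi fun i => (D i).toContinuousLinearMap).prod (fderiv ℝ b x),
    HasFDerivAt.prodMk (hasFDerivAt_pi.2 fun i => ?_) (hb x).hasFDerivAt,
    fun h => ⟨fun i t => rfl, rfl⟩⟩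
  refine HasFDerivAt.of_isLittleO (Asymptotics.isLittleO_iff.2 fun ε hε => ?_)
  filter_upwards [eventually_uniform_taylor (hg_diff i) (hg_grad i) x hε] with z hz
  exact (ContinuousMap.norm_le _ (by positivity)).2 fun t => hz t

/-- Robinson's constraint qualification provides strict solutions of the linearised inequality
constraints with every small value of the linearised equality constraint. -/
theorem RobinsonCQ.exists_strict {g : Fin l → EuclideanSpace ℝ (Fin d) → T → ℝ}
    {hg : ∀ i, Continuous fun p : EuclideanSpace ℝ (Fin d) × T => g i p.1 p.2}
    (hg_diff : ∀ i t, Differentiable ℝ fun x => g i x t)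
    (hg_grad : ∀ i, Continuous fun p : EuclideanSpace ℝ (Fin d) × T =>
      fderiv ℝ (fun x => g i x p.2) p.1)
    {b : EuclideanSpace ℝ (Fin d) → EuclideanSpace ℝ (Fin s)} (hb : Differentiable ℝ b)
    {A : Set (EuclideanSpace ℝ (Fin d))} {x : EuclideanSpace ℝ (Fin d)} (hbx : b x = 0)
    (hR : RobinsonCQ A (semiInfMap g hg b) (semiInfCone l s T) x) :
    ∃ ε > 0, ∀ z, ‖z‖ ≤ ε → ∃ a ∈ A,
      (∀ i t, g i x t + fderiv ℝ (fun x => g i x t) x (a - x) < 0) ∧ fderiv ℝ b x (a - x) = z := by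
  obtain ⟨L, hL, hLh⟩ := exists_hasFDerivAt_semiInfMap hg hg_diff hg_grad hb x
  obtain ⟨ε, hε, hball⟩ := Metric.mem_nhds_iff.1 (mem_interior_iff_mem_nhds.1 hR)
  refine ⟨ε / 2, half_pos hε, fun z hz => ?_⟩
  -- RCQ is tested on the constant functions `-(ε / 2)`; removing the nonpositive `k` preserves this
  -- margin in every inequality.
  have hmem : ((fun _ => ContinuousMap.const T (-(ε / 2)), z) :
      (Fin l → C(T, ℝ)) × EuclideanSpace ℝ (Fin s)) ∈ Metric.ball 0 ε := by
    rw [mem_ball_zero_iff]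
    refine lt_of_le_of_lt (b := ε / 2) (max_le ?_ hz) (half_lt_self hε)
    refine (pi_norm_le_iff_of_nonneg (half_pos hε).le).2 fun i => ?_
    refine (ContinuousMap.norm_le _ (half_pos hε).le).2 fun t => ?_
    simp [abs_of_pos hε]
  obtain ⟨a, ha, k, hk, hy⟩ := hball hmem
  rw [hL.fderiv] at hy
  refine ⟨a, ha, fun i t => ?_, ?_⟩
  · have h1 := congrArg (fun y => y.1 i t) hy
    have h2 : -(ε / 2) = g i x t + (L (a - x)).1 i t - k.1 i t := h1
    rw [(hLh _).1] at h2
    linarith [hk.1 i t]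
  · have h1 : z = b x + (L (a - x)).2 - k.2 := congrArg Prod.snd hy
    rw [(hLh _).2, hbx, hk.2] at h1
    simpa using h1.symm

end Differentiability

/-! ### Right inverses adapted to `A` and correction onto the level set of `b`. -/

section Regularity

variable {E : Type*} [NormedAddCommGroup E] [NormedSpace ℝ E] {s : ℕ}

/-- If the linear mapping `B` maps `A - x₀` onto a neighbourhood of zero, then it has a linear
right inverse `σ` such that `A` contains a small piece `x̂ + σ u` of the image of `σ`. -/
theorem exists_regular_point {A : Set E} (hA : Convex ℝ A) (B : E →L[ℝ] EuclideanSpace ℝ (Fin s))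
    (x₀ : E) (h : ∃ ε > 0, ∀ z, ‖z‖ ≤ ε → ∃ a ∈ A, B (a - x₀) = z) :
    ∃ (y : E) (σ : EuclideanSpace ℝ (Fin s) →L[ℝ] E), B (y - x₀) = 0 ∧ (∀ u, B (σ u) = u) ∧
      ∃ δ > 0, ∀ u, ‖u‖ ≤ δ → y + σ u ∈ A := by
  obtain ⟨ε, hε, h⟩ := h
  obtain ⟨a₀, ha₀, hB₀⟩ := h 0 (by simpa using hε.le)
  have hp : ∀ k : Fin s, ∃ a ∈ A, B (a - x₀) = ε • EuclideanSpace.single k (1 : ℝ) := fun k =>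
    h _ (by simp [norm_smul, abs_of_pos hε])
  have hq : ∀ k : Fin s, ∃ a ∈ A, B (a - x₀) = -(ε • EuclideanSpace.single k (1 : ℝ)) := fun k =>
    h _ (by simp [norm_smul, abs_of_pos hε])
  choose p hpA hpB using hp
  choose q hqA hqB using hq
  have hN : (0 : ℝ) < 2 * s + 1 := by positivity
  -- The base point is the equal-weight average of `a₀`, all `p k` and all `q k`, that is, of `2 * s
  -- + 1` points of `A`.
  set w : ℝ := (2 * s + 1)⁻¹ with hw
  have hw0 : 0 < w := inv_pos.2 hN
  have hw1 : w + ∑ _k : Fin s, (w + w) = 1 := by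
    simp only [Finset.sum_const, Finset.card_univ, Fintype.card_fin, nsmul_eq_mul]
    rw [hw]; field_simp; ring
  let σ : EuclideanSpace ℝ (Fin s) →L[ℝ] E :=
    ∑ k, (EuclideanSpace.proj k : EuclideanSpace ℝ (Fin s) →L[ℝ] ℝ).smulRight
      ((2 * ε)⁻¹ • (p k - q k))
  have hσ : ∀ u, σ u = ∑ k, u k • (2 * ε)⁻¹ • (p k - q k) := fun u => by
    simp [σ, sum_apply]
  refine ⟨w • a₀ + ∑ k, (w • p k + w • q k), σ, ?_, fun u => ?_, 2 * ε * w, by positivity,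
    fun u hu => ?_⟩
  · have : w • a₀ + ∑ k, (w • p k + w • q k) - x₀ =
        w • (a₀ - x₀) + ∑ k, (w • (p k - x₀) + w • (q k - x₀)) := by
      have h1 : x₀ = w • x₀ + ∑ _k : Fin s, (w • x₀ + w • x₀) := by
        simp only [← add_smul, ← Finset.sum_smul, hw1, one_smul]
      conv_lhs => rw [h1]
      simp only [smul_sub, Finset.sum_add_distrib, Finset.sum_sub_distrib]
      abel
    rw [this]
    simp [map_sum, -map_sub, hB₀, hpB, hqB]
  · have h1 : ∀ k, B (p k - q k) = (2 * ε) • EuclideanSpace.single k (1 : ℝ) := fun k => by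
      rw [← sub_sub_sub_cancel_right (p k) (q k) x₀, map_sub, hpB, hqB]; module
    rw [hσ, map_sum]
    simp only [map_smul, h1, inv_smul_smul₀ (by positivity : 2 * ε ≠ 0)]
    simpa using (EuclideanSpace.basisFun (Fin s) ℝ).sum_repr u
  · have hk : ∀ k, |u k| * (2 * ε)⁻¹ ≤ w := fun k => by
      rw [mul_inv_le_iff₀ (by positivity), mul_comm]
      exact (PiLp.norm_apply_le u k).trans hu
    have hk' : ∀ k, |u k * (2 * ε)⁻¹| ≤ w := fun k => by
      rw [abs_mul, abs_of_pos (show 0 < (2 * ε)⁻¹ by positivity)]; exact hk k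
    -- Adding `σ u` only shifts the weights of `p k` and `q k` by `± u k / (2 * ε)`. They keep their
    -- total and stay nonnegative while `‖u‖ ≤ 2 * ε * w`.
    have hsum := hA.sum_mem (t := (Finset.univ : Finset (Option (Fin s ⊕ Fin s))))
      (w := fun o => o.elim w (Sum.elim (fun k => w + u k * (2 * ε)⁻¹)
        fun k => w - u k * (2 * ε)⁻¹))
      (z := fun o => o.elim a₀ (Sum.elim p q))
      (by
        rintro (_ | k | k) -
        · exact hw0.le
        · have := (abs_le.1 (hk' k)).1
          simp only [Option.elim, Sum.elim_inl]; linarith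
        · have := (abs_le.1 (hk' k)).2
          simp only [Option.elim, Sum.elim_inr]; linarith)
      (by
        simp only [Fintype.sum_option, Fintype.sum_sum_type, Option.elim, Sum.elim_inl,
          Sum.elim_inr, ← Finset.sum_add_distrib]
        rw [← hw1]
        congr 1
        exact Finset.sum_congr rfl fun k _ => by ring)
      (by rintro (_ | k | k) - <;> simp [ha₀, hpA, hqA])
    convert! hsum using 1
    simp only [Fintype.sum_option, Fintype.sum_sum_type, Option.elim, Sum.elim_inl, Sum.elim_inr,
      hσ, ← Finset.sum_add_distrib, add_assoc]
    congr 1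
    exact Finset.sum_congr rfl fun k _ => by module

variable {Y : Type*} [NormedAddCommGroup Y] [NormedSpace ℝ Y] [CompleteSpace Y]

/-- A tangent direction of a `C¹` equality constraint with surjective derivative can be corrected
to a curve in the level set. -/
theorem exists_correction {b : E → Y} {x₀ : E} {B : E →L[ℝ] Y} (hb : HasStrictFDerivAt b B x₀)
    {σ : Y →L[ℝ] E} (hσ : ∀ u, B (σ u) = u) {h : E} (hh : B h = 0) :
    ∃ u : ℝ → Y, Tendsto (fun τ : ℝ => τ⁻¹ • u τ) (𝓝[>] 0) (𝓝 0) ∧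
      ∀ᶠ τ in 𝓝[>] (0 : ℝ), b (x₀ + τ • h + σ (u τ)) = b x₀ := by
  let M : ℝ × Y →L[ℝ] E :=
    (ContinuousLinearMap.fst ℝ ℝ Y).smulRight h + σ.comp (ContinuousLinearMap.snd ℝ ℝ Y)
  have hM : ∀ p, M p = p.1 • h + σ p.2 := fun p => by simp [M]
  -- Since `B h = 0` and `B ∘ σ = id`, the derivative of `Ψ` at `0` is the identity, and so is that
  -- of its local inverse. Along `(τ, b x₀)` the second coordinate of the inverse therefore has
  -- derivative zero.
  let Ψ : ℝ × Y → ℝ × Y := fun p => (p.1, b (x₀ + M p))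
  have hΨ : HasStrictFDerivAt Ψ
      ((ContinuousLinearEquiv.refl ℝ (ℝ × Y) : (ℝ × Y) ≃L[ℝ] ℝ × Y) : ℝ × Y →L[ℝ] ℝ × Y) 0 := by
    have h1 : HasStrictFDerivAt (fun p => x₀ + M p) M (0 : ℝ × Y) :=
      M.hasStrictFDerivAt.const_add x₀
    have h2 : HasStrictFDerivAt b B (x₀ + M (0 : ℝ × Y)) := by simpa using hb
    convert! (hasStrictFDerivAt_fst (𝕜 := ℝ) (p := (0 : ℝ × Y))).prodMk (h2.comp 0 h1) using 1
    ext p <;> simp [hM, hh, hσ]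
  have hΨ0 : Ψ 0 = (0, b x₀) := by simp [Ψ]
  let G := hΨ.localInverse Ψ _ 0
  have hG0 : G (0, b x₀) = 0 := by
    have := hΨ.localInverse_apply_image
    rwa [hΨ0] at this
  have hGd : HasFDerivAt G (ContinuousLinearMap.id ℝ (ℝ × Y)) (0, b x₀) := by
    have := hΨ.to_localInverse.hasFDerivAt
    rwa [hΨ0] at this
  have hline : HasDerivAt (fun τ : ℝ => (τ, b x₀)) ((1 : ℝ), (0 : Y)) 0 :=
    (hasDerivAt_id 0).prodMk (hasDerivAt_const 0 (b x₀))
  have hud : HasDerivAt (fun τ : ℝ => (G (τ, b x₀)).2) 0 0 := by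
    exact (hasFDerivAt_snd (𝕜 := ℝ) (p := G (0, b x₀))).comp_hasDerivAt (0 : ℝ)
      (hGd.comp_hasDerivAt (0 : ℝ) hline)
  refine ⟨fun τ => (G (τ, b x₀)).2, ?_, ?_⟩
  · simpa [hG0] using hud.tendsto_slope_zero_right
  · have hr := hΨ.eventually_right_inverse
    rw [hΨ0] at hr
    have ht : Tendsto (fun τ : ℝ => (τ, b x₀)) (𝓝[>] 0) (𝓝 (0, b x₀)) :=
      hline.continuousAt.tendsto.mono_left inf_le_left
    filter_upwards [ht.eventually hr] with τ hτ
    have h1 : (G (τ, b x₀)).1 = τ := congrArg Prod.fst hτ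
    have h2 : b (x₀ + M (G (τ, b x₀))) = b x₀ := congrArg Prod.snd hτ
    rw [hM, h1] at h2
    rwa [add_assoc]

end Regularity

/-! ### Directional derivatives and a criterion for multipliers. -/

section General

variable {E Y : Type*} [NormedAddCommGroup E] [NormedSpace ℝ E]
  [NormedAddCommGroup Y] [NormedSpace ℝ Y]

theorem HasDirDeriv.add {φ ψ : E → ℝ} {x h : E} {D D' : ℝ} (hφ : HasDirDeriv φ x h D)
    (hψ : HasDirDeriv ψ x h D') : HasDirDeriv (fun z => φ z + ψ z) x h (D + D') := by
  refine (Tendsto.add hφ hψ).congr fun α => ?_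
  ring

theorem _root_.HasFDerivAt.hasDirDeriv {φ : E → ℝ} {L : StrongDual ℝ E} {x : E}
    (hφ : HasFDerivAt φ L x) (h : E) : HasDirDeriv φ x h (L h) := by
  have h1 : HasDerivAt (fun τ : ℝ => x + τ • h) h 0 := by
    simpa using ((hasDerivAt_id (0 : ℝ)).smul_const h).const_add x
  have h2 : HasFDerivAt φ L (x + (0 : ℝ) • h) := by simpa using hφ
  refine ((h2.comp_hasDerivAt (0 : ℝ) h1).tendsto_slope_zero_right).congr fun τ => ?_
  simp [inv_mul_eq_div]

/-- Each `v n` is a positive multiple of a vector in `A - x`; the sign survives the limit. -/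
theorem nonneg_of_mem_contingentCone {A : Set E} {x h : E} (hh : h ∈ contingentCone A x)
    (L : StrongDual ℝ E) (hL : ∀ a ∈ A, 0 ≤ L (a - x)) : 0 ≤ L h := by
  obtain ⟨α, v, hα, -, hv, hA⟩ := hh
  refine ge_of_tendsto' ((L.continuous.tendsto h).comp hv) fun n => ?_
  have := hL _ (hA n)
  rw [add_sub_cancel_left, map_smul, smul_eq_mul] at this
  exact nonneg_of_mul_nonneg_right this (hα n)

/-- A sufficient condition for Lagrange multipliers of a minimax problem, in terms of a functional
`Θ` below the directional derivative of the max-function. -/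
theorem isLagrangeMultiplier_of_forall_nonneg {W : Type*} [TopologicalSpace W] [CompactSpace W]
    [Nonempty W] {f : E → W → ℝ} (hf : Continuous fun p : E × W => f p.1 p.2)
    (hf_diff : ∀ ω, Differentiable ℝ fun x => f x ω)
    (hf_grad : Continuous fun p : E × W => fderiv ℝ (fun x => f x p.2) p.1)
    {A : Set E} {G : E → Y} {K : Set Y} {x : E} (hx : x ∈ feasibleRegion A G K)
    {L : E →L[ℝ] Y} (hG : HasFDerivAt G L x) {lam : StrongDual ℝ Y} (hpol : lam ∈ polarCone K)
    (hcompl : lam (G x) = 0) (Θ : StrongDual ℝ E)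
    (hΘ : ∀ h D, (∀ ω, f x ω = maxFun f x → fderiv ℝ (fun x => f x ω) x h ≤ D) → Θ h ≤ D)
    (hnonneg : ∀ a ∈ A, 0 ≤ Θ (a - x) + lam (L (a - x))) :
    IsLagrangeMultiplier (maxFun f) A G K x lam := by
  refine ⟨hx, hpol, hcompl, fun h hh => ?_⟩
  obtain ⟨D, hD, hDω⟩ := exists_hasDirDeriv_maxFun hf hf_diff hf_grad x h
  have hlG : HasFDerivAt (fun z => lam (G z)) (lam.comp L) x := lam.hasFDerivAt.comp x hG
  refine ⟨D + lam (L h), hD.add (hlG.hasDirDeriv h), ?_⟩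
  have h1 := nonneg_of_mem_contingentCone hh (Θ + lam.comp L) hnonneg
  have h2 : 0 ≤ Θ h + lam (L h) := h1
  linarith [hΘ h D hDω]

end General

/-! ### Functionals of finite sums of Dirac measures. -/

section Measures

theorem exists_finiteMeasure_eq_sum_dirac {T : Type*} [MeasurableSpace T] (m : ℕ)
    (t : Fin m → T) (c : Fin m → ℝ≥0) :
    ∃ μ : FiniteMeasure T, (μ : Measure T) = ∑ j, c j • Measure.dirac (t j) :=
  ⟨⟨∑ j, c j • Measure.dirac (t j), inferInstance⟩, rfl⟩

variable {s l : ℕ} {T : Type*} [MetricSpace T] [CompactSpace T] [MeasurableSpace T] [BorelSpace T]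

theorem measureFunctional_apply_of_eq_sum_dirac {μ : Fin l → FiniteMeasure T} {m : Fin l → ℕ}
    {t : ∀ i, Fin (m i) → T} {c : ∀ i, Fin (m i) → ℝ≥0}
    (hμ : ∀ i, (μ i : Measure T) = ∑ j, c i j • Measure.dirac (t i j))
    (ν : EuclideanSpace ℝ (Fin s)) (y : (Fin l → C(T, ℝ)) × EuclideanSpace ℝ (Fin s)) :
    measureFunctional μ ν y = ∑ i, ∑ j, (c i j : ℝ) * y.1 i (t i j) + inner ℝ ν y.2 := by
  rw [measureFunctional_apply]
  congr 1
  refine Finset.sum_congr rfl fun i _ => ?_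
  rw [hμ, integral_finsetSum_measure]
  · refine Finset.sum_congr rfl fun j _ => ?_
    rw [integral_smul_nnreal_measure, integral_dirac, NNReal.smul_def, smul_eq_mul]
  · intro j _
    exact (y.1 i).continuous.integrable_of_hasCompactSupport (HasCompactSupport.of_compactSpace _)

theorem measureFunctional_mem_polarCone (μ : Fin l → FiniteMeasure T)
    (ν : EuclideanSpace ℝ (Fin s)) : measureFunctional μ ν ∈ polarCone (semiInfCone l s T) := by
  rintro y ⟨hy1, hy2⟩
  rw [measureFunctional_apply, hy2, inner_zero_right, add_zero]
  exact Finset.sum_nonpos fun i _ => integral_nonpos fun t => hy1 i t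

end Measures

/-! ### The linearised system at a local minimum. -/

section NecessaryConditions

variable {d s l : ℕ} {W : Type*} [TopologicalSpace W] [CompactSpace W] [Nonempty W]
  {T : Type*} [MetricSpace T] [CompactSpace T]
  {A : Set (EuclideanSpace ℝ (Fin d))} {f : EuclideanSpace ℝ (Fin d) → W → ℝ}
  {g : Fin l → EuclideanSpace ℝ (Fin d) → T → ℝ}
  {b : EuclideanSpace ℝ (Fin d) → EuclideanSpace ℝ (Fin s)} {x : EuclideanSpace ℝ (Fin d)}

/-- At a local minimum satisfying a constraint qualification for the equality constraint, the
linearised system of strict inequalities has no solution. -/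
theorem exists_nonneg_of_isLocallyOptimal (hA : Convex ℝ A)
    (hf : Continuous fun p : EuclideanSpace ℝ (Fin d) × W => f p.1 p.2)
    (hf_diff : ∀ ω, Differentiable ℝ fun x => f x ω)
    (hf_grad : Continuous fun p : EuclideanSpace ℝ (Fin d) × W =>
      fderiv ℝ (fun x => f x p.2) p.1)
    (hg : ∀ i, Continuous fun p : EuclideanSpace ℝ (Fin d) × T => g i p.1 p.2)
    (hg_diff : ∀ i t, Differentiable ℝ fun x => g i x t)
    (hg_grad : ∀ i, Continuous fun p : EuclideanSpace ℝ (Fin d) × T =>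
      fderiv ℝ (fun x => g i x p.2) p.1)
    (hb : ContDiff ℝ 1 b)
    (hopt : IsLocallyOptimal (maxFun f) (feasibleRegion A (semiInfMap g hg b)
      (semiInfCone l s T)) x)
    (hreg : ∃ ε > 0, ∀ z, ‖z‖ ≤ ε → ∃ a ∈ A, fderiv ℝ b x (a - x) = z)
    {a : EuclideanSpace ℝ (Fin d)} (ha : a ∈ A) (hBa : fderiv ℝ b x (a - x) = 0) :
    (∃ ω, 0 ≤ f x ω - maxFun f x + fderiv ℝ (fun x => f x ω) x (a - x)) ∨
      ∃ i t, 0 ≤ g i x t + fderiv ℝ (fun x => g i x t) x (a - x) := by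
  obtain ⟨hxA, hxg, hxb⟩ := hopt.1
  replace hxb : b x = 0 := hxb
  replace hxg : ∀ i t, g i x t ≤ 0 := hxg
  by_contra! hcon
  obtain ⟨hconf, hcong⟩ := hcon
  obtain ⟨y, σ, hBy, hσ, δ, hδ, hyA⟩ := exists_regular_point hA (fderiv ℝ b x) x hreg
  have hopenf : ∀ᶠ a' in 𝓝 a, ∀ ω,
      f x ω - maxFun f x + fderiv ℝ (fun x => f x ω) x (a' - x) < 0 := by
    refine eventually_forall_of_compactSpace
      (P := fun a' ω => f x ω - maxFun f x + fderiv ℝ (fun x => f x ω) x (a' - x) < 0) fun ω => ?_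
    rw [← nhds_prod_eq]
    have hc : Continuous fun p : EuclideanSpace ℝ (Fin d) × W =>
        f x p.2 - maxFun f x + fderiv ℝ (fun x => f x p.2) x (p.1 - x) :=
      ((hf.comp (by fun_prop : Continuous fun p : EuclideanSpace ℝ (Fin d) × W => (x, p.2))).sub
        continuous_const).add ((hf_grad.comp (by fun_prop : Continuous
          fun p : EuclideanSpace ℝ (Fin d) × W => (x, p.2))).clm_apply (by fun_prop))
    exact hc.continuousAt.eventually_lt continuousAt_const (hconf ω)
  have hopeng : ∀ᶠ a' in 𝓝 a, ∀ i t,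
      g i x t + fderiv ℝ (fun x => g i x t) x (a' - x) < 0 := by
    refine eventually_all.2 fun i => eventually_forall_of_compactSpace
      (P := fun a' t => g i x t + fderiv ℝ (fun x => g i x t) x (a' - x) < 0) fun t => ?_
    rw [← nhds_prod_eq]
    have hc : Continuous fun p : EuclideanSpace ℝ (Fin d) × T =>
        g i x p.2 + fderiv ℝ (fun x => g i x p.2) x (p.1 - x) :=
      ((hg i).comp (by fun_prop : Continuous
        fun p : EuclideanSpace ℝ (Fin d) × T => (x, p.2))).add (((hg_grad i).comp
          (by fun_prop : Continuous fun p : EuclideanSpace ℝ (Fin d) × T => (x, p.2))).clm_apply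
            (by fun_prop))
    exact hc.continuousAt.eventually_lt continuousAt_const (hcong i t)
  -- Strict inequalities survive a small move from `a` towards `y`; the positive share `θ` of `y`
  -- buys room in `A` for the correction `σ (u τ)`.
  obtain ⟨θ, hθf, hθg, hθ0, hθ1⟩ : ∃ θ : ℝ,
      (∀ ω, f x ω - maxFun f x + fderiv ℝ (fun x => f x ω) x ((1 - θ) • a + θ • y - x) < 0) ∧
      (∀ i t, g i x t + fderiv ℝ (fun x => g i x t) x ((1 - θ) • a + θ • y - x) < 0) ∧
      0 < θ ∧ θ < 1 := by
    have ht : Tendsto (fun θ : ℝ => (1 - θ) • a + θ • y) (𝓝[>] 0) (𝓝 a) := by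
      have hc : Continuous fun θ : ℝ => (1 - θ) • a + θ • y := by fun_prop
      exact (by simpa using hc.tendsto 0 : Tendsto (fun θ : ℝ => (1 - θ) • a + θ • y) (𝓝 0)
        (𝓝 a)).mono_left inf_le_left
    exact ((ht.eventually hopenf).and ((ht.eventually hopeng).and
      (eventually_mem_nhdsWithin.and (mem_nhdsWithin_of_mem_nhds
        (Iio_mem_nhds (zero_lt_one' ℝ)))))).exists
  set h := (1 - θ) • a + θ • y - x with hh
  have hBh : fderiv ℝ b x h = 0 := by
    have : h = (1 - θ) • (a - x) + θ • (y - x) := by rw [hh]; module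
    rw [this, map_add, map_smul, map_smul, hBa, hBy]; simp
  obtain ⟨u, hu, hub⟩ := exists_correction (hb.contDiffAt.hasStrictFDerivAt one_ne_zero) hσ hBh
  have hpos : ∀ᶠ τ in 𝓝[>] (0 : ℝ), 0 < τ := eventually_mem_nhdsWithin
  have hlt1 : ∀ᶠ τ in 𝓝[>] (0 : ℝ), τ < 1 :=
    mem_nhdsWithin_of_mem_nhds (Iio_mem_nhds zero_lt_one)
  set c : ℝ → EuclideanSpace ℝ (Fin d) := fun τ => x + τ • h + σ (u τ) with hc
  have hcurve : Tendsto (fun τ : ℝ => τ⁻¹ • (c τ - x)) (𝓝[>] 0) (𝓝 h) := by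
    have h1 : Tendsto (fun τ : ℝ => h + σ (τ⁻¹ • u τ)) (𝓝[>] 0) (𝓝 (h + σ 0)) :=
      tendsto_const_nhds.add ((σ.continuous.tendsto 0).comp hu)
    rw [map_zero, add_zero] at h1
    refine h1.congr' ?_
    filter_upwards [hpos] with τ hτ
    rw [show c τ - x = τ • h + σ (u τ) by simp only [hc]; abel, map_smul, smul_add,
      inv_smul_smul₀ hτ.ne']
  have hc0 : Tendsto c (𝓝[>] 0) (𝓝 x) := by
    have h1 : Tendsto (fun τ : ℝ => x + τ • (τ⁻¹ • (c τ - x))) (𝓝[>] 0) (𝓝 (x + (0 : ℝ) • h)) :=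
      tendsto_const_nhds.add ((tendsto_id.mono_left inf_le_left).smul hcurve)
    rw [zero_smul, add_zero] at h1
    refine h1.congr' ?_
    filter_upwards [hpos] with τ hτ
    rw [smul_inv_smul₀ hτ.ne']; abel
  have hcA : ∀ᶠ τ in 𝓝[>] (0 : ℝ), c τ ∈ A := by
    filter_upwards [hpos, hlt1, hu.norm.eventually_le_const
      (show ‖(0 : EuclideanSpace ℝ (Fin s))‖ < θ * δ by simpa using mul_pos hθ0 hδ)] with τ hτ hτ1 hτu
    -- The curve is a nested convex combination: `c τ = (1 - τ) x + τ ((1 - θ) a + θ (y + σ (θ⁻¹ τ⁻¹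
    -- u τ)))`, and the inner argument is small because `u τ = o(τ)`.
    have h1 : y + σ (θ⁻¹ • τ⁻¹ • u τ) ∈ A := hyA _ (by
      rw [norm_smul, Real.norm_of_nonneg (inv_pos.2 hθ0).le, inv_mul_le_iff₀ hθ0]
      exact hτu)
    have h2 := hA ha h1 (sub_nonneg.2 hθ1.le) hθ0.le (sub_add_cancel _ _)
    have h3 := hA hxA h2 (sub_nonneg.2 hτ1.le) hτ.le (sub_add_cancel _ _)
    convert! h3 using 1
    rw [smul_add θ, map_smul, smul_inv_smul₀ hθ0.ne', ← add_assoc, smul_add τ, map_smul,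
      smul_inv_smul₀ hτ.ne', hc, hh]
    module
  have hcg : ∀ᶠ τ in 𝓝[>] (0 : ℝ), ∀ i t, g i (c τ) t ≤ 0 := by
    refine eventually_all.2 fun i => ?_
    filter_upwards [eventually_forall_lt_along_curve (hg i) (hg_diff i) (hg_grad i) hcurve
      (r := 0) (hxg i) fun t ht => by have := hθg i t; rwa [ht, zero_add] at this] with τ hτ t
    simpa using (hτ t).le
  have hcf : ∀ᶠ τ in 𝓝[>] (0 : ℝ), maxFun f (c τ) < maxFun f x := by
    filter_upwards [eventually_forall_lt_along_curve (φ := fun z ω => f z ω - maxFun f x)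
      (hf.sub continuous_const) (fun ω => (hf_diff ω).sub_const _)
      (by simpa only [fderiv_sub_const] using hf_grad) hcurve (r := 0)
      (fun ω => sub_nonpos.2 (le_maxFun hf x ω))
      (fun ω hω => by
        rw [fderiv_sub_const]
        have := hθf ω
        rwa [show f x ω - maxFun f x = 0 from hω, zero_add] at this)] with τ hτ
    obtain ⟨ω, hω⟩ := exists_eq_maxFun hf (c τ)
    have := hτ ω
    rw [hω] at this
    linarith
  have hcS : Tendsto c (𝓝[>] 0)
      (𝓝[feasibleRegion A (semiInfMap g hg b) (semiInfCone l s T)] x) := by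
    refine tendsto_nhdsWithin_iff.2 ⟨hc0, ?_⟩
    filter_upwards [hcA, hcg, hub] with τ h1 h2 h3
    exact ⟨h1, h2, h3.trans hxb⟩
  obtain ⟨τ, h1, h2⟩ := ((hcS.eventually hopt.2).and hcf).exists
  exact h1.not_gt h2

end NecessaryConditions

/-! ### Existence of discrete Lagrange multipliers. -/

section Existence

variable {d s l : ℕ} {W : Type*} [TopologicalSpace W] [CompactSpace W] [Nonempty W]
  {T : Type*} [MetricSpace T] [CompactSpace T]
  {A : Set (EuclideanSpace ℝ (Fin d))} {f : EuclideanSpace ℝ (Fin d) → W → ℝ}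
  {g : Fin l → EuclideanSpace ℝ (Fin d) → T → ℝ}
  {b : EuclideanSpace ℝ (Fin d) → EuclideanSpace ℝ (Fin s)} {x : EuclideanSpace ℝ (Fin d)}

theorem finrank_strongDual_euclideanSpace (d : ℕ) :
    Module.finrank ℝ (StrongDual ℝ (EuclideanSpace ℝ (Fin d))) = d := by
  rw [← (InnerProductSpace.toDual ℝ (EuclideanSpace ℝ (Fin d))).toLinearEquiv.finrank_eq,
    finrank_euclideanSpace_fin]

/-- Finitely many multipliers at a locally optimal solution, in the form of a positive combination
of the linearised functions. -/
theorem exists_weights_of_isLocallyOptimal (hA : Convex ℝ A)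
    (hf : Continuous fun p : EuclideanSpace ℝ (Fin d) × W => f p.1 p.2)
    (hf_diff : ∀ ω, Differentiable ℝ fun x => f x ω)
    (hf_grad : Continuous fun p : EuclideanSpace ℝ (Fin d) × W =>
      fderiv ℝ (fun x => f x p.2) p.1)
    (hg : ∀ i, Continuous fun p : EuclideanSpace ℝ (Fin d) × T => g i p.1 p.2)
    (hg_diff : ∀ i t, Differentiable ℝ fun x => g i x t)
    (hg_grad : ∀ i, Continuous fun p : EuclideanSpace ℝ (Fin d) × T =>
      fderiv ℝ (fun x => g i x p.2) p.1)
    (hb : ContDiff ℝ 1 b)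
    (hopt : IsLocallyOptimal (maxFun f) (feasibleRegion A (semiInfMap g hg b)
      (semiInfCone l s T)) x)
    (hreg : ∃ ε > 0, ∀ z, ‖z‖ ≤ ε → ∃ a ∈ A, fderiv ℝ b x (a - x) = z) :
    ∃ (ι : Type) (_ : Fintype ι) (w : ι → ℝ) (p : ι → W ⊕ (Σ _ : Fin l, T))
      (ν : EuclideanSpace ℝ (Fin s)), w ∈ stdSimplex ℝ ι ∧
      ∀ a ∈ A, 0 ≤ ∑ k, w k * (Sum.elim (fun ω => f x ω - maxFun f x) (fun q => g q.1 x q.2) (p k) +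
        (Sum.elim (fun ω => fderiv ℝ (fun x => f x ω) x)
          (fun q => fderiv ℝ (fun x => g q.1 x q.2) x) (p k) :
            StrongDual ℝ (EuclideanSpace ℝ (Fin d))) (a - x)) +
        inner ℝ ν (fderiv ℝ b x (a - x)) := by
  refine exists_multipliers_of_forall_exists (S := W ⊕ (Σ _ : Fin l, T)) ?_ ?_ hA (fderiv ℝ b x) x
    ?_ ?_
  · refine Continuous.sumElim ?_ (continuous_sigma fun i => ?_)
    · exact (hf.comp (by fun_prop : Continuous fun ω : W => (x, ω))).sub continuous_const
    · exact (hg i).comp (by fun_prop : Continuous fun t : T => (x, t))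
  · refine Continuous.sumElim ?_ (continuous_sigma fun i => ?_)
    · exact hf_grad.comp (by fun_prop : Continuous fun ω : W => (x, ω))
    · exact (hg_grad i).comp (by fun_prop : Continuous fun t : T => (x, t))
  · obtain ⟨y, σ, hy, hσ, δ, hδ, hyA⟩ := exists_regular_point hA (fderiv ℝ b x) x hreg
    refine ⟨δ, hδ, ‖y - x‖ + ‖σ‖ * δ, fun u hu => ⟨y + σ u, hyA u hu, ?_, ?_⟩⟩
    · rw [add_sub_right_comm, map_add, hy, hσ, zero_add]
    · rw [add_sub_right_comm]
      exact (norm_add_le _ _).trans (by gcongr; exact σ.le_opNorm_of_le hu)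
  · intro a ha hBa
    rcases exists_nonneg_of_isLocallyOptimal hA hf hf_diff hf_grad hg hg_diff hg_grad hb hopt hreg
      ha hBa with ⟨ω, hω⟩ | ⟨i, t, hit⟩
    · exact ⟨Sum.inl ω, hω⟩
    · exact ⟨Sum.inr ⟨i, t⟩, hit⟩

theorem exists_isDiscreteLagrangeMultiplier_of_isLocallyOptimal [Nonempty T] [MeasurableSpace T]
    [BorelSpace T] (hA : Convex ℝ A)
    (hf : Continuous fun p : EuclideanSpace ℝ (Fin d) × W => f p.1 p.2)
    (hf_diff : ∀ ω, Differentiable ℝ fun x => f x ω)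
    (hf_grad : Continuous fun p : EuclideanSpace ℝ (Fin d) × W =>
      fderiv ℝ (fun x => f x p.2) p.1)
    (hg : ∀ i, Continuous fun p : EuclideanSpace ℝ (Fin d) × T => g i p.1 p.2)
    (hg_diff : ∀ i t, Differentiable ℝ fun x => g i x t)
    (hg_grad : ∀ i, Continuous fun p : EuclideanSpace ℝ (Fin d) × T =>
      fderiv ℝ (fun x => g i x p.2) p.1)
    (hb : ContDiff ℝ 1 b)
    (hopt : IsLocallyOptimal (maxFun f) (feasibleRegion A (semiInfMap g hg b)
      (semiInfCone l s T)) x)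
    (hstrict : ∃ ε > 0, ∀ z, ‖z‖ ≤ ε → ∃ a ∈ A,
      (∀ i t, g i x t + fderiv ℝ (fun x => g i x t) x (a - x) < 0) ∧ fderiv ℝ b x (a - x) = z) :
    ∃ μ ν, IsDiscreteLagrangeMultiplier (maxFun f) A g hg b x μ ν := by
  classical
  obtain ⟨hxA, hxg, hxb⟩ := hopt.1
  replace hxb : b x = 0 := hxb
  replace hxg : ∀ i t, g i x t ≤ 0 := hxg
  obtain ⟨ι, _, w, p, ν, ⟨hw, hw1⟩, hmult⟩ := exists_weights_of_isLocallyOptimal hA hf hf_diff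
    hf_grad hg hg_diff hg_grad hb hopt (by
      obtain ⟨ε, hε, h⟩ := hstrict
      exact ⟨ε, hε, fun z hz => (h z hz).imp fun a ha => ⟨ha.1, ha.2.2⟩⟩)
  set ψ : W ⊕ (Σ _ : Fin l, T) → ℝ :=
    Sum.elim (fun ω => f x ω - maxFun f x) fun q => g q.1 x q.2 with hψ
  set D : W ⊕ (Σ _ : Fin l, T) → StrongDual ℝ (EuclideanSpace ℝ (Fin d)) :=
    Sum.elim (fun ω => fderiv ℝ (fun x => f x ω) x)
      fun q => fderiv ℝ (fun x => g q.1 x q.2) x with hD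
  have hψ0 : ∀ q, ψ q ≤ 0 := by
    rintro (ω | ⟨i, t⟩)
    · exact sub_nonpos.2 (le_maxFun hf x ω)
    · exact hxg i t
  -- At `a = x` a sum of nonpositive terms is nonnegative, so each term vanishes: this is
  -- complementarity.
  have hact : ∀ k, w k * ψ (p k) = 0 := by
    have h1 : 0 ≤ ∑ k, w k * ψ (p k) := by simpa using hmult x hxA
    have h2 : ∀ k ∈ Finset.univ, w k * ψ (p k) ≤ 0 := fun k _ =>
      mul_nonpos_of_nonneg_of_nonpos (hw k) (hψ0 _)
    have h3 := (Finset.sum_eq_zero_iff_of_nonpos h2).1 (le_antisymm (Finset.sum_nonpos h2) h1)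
    exact fun k => h3 k (Finset.mem_univ k)
  have hmult' : ∀ a ∈ A, 0 ≤ ∑ k, w k * D (p k) (a - x) + inner ℝ ν (fderiv ℝ b x (a - x)) := by
    intro a ha
    simpa only [mul_add, hact, zero_add] using hmult a ha
  let J₀ : Finset ι := Finset.univ.filter fun k => ∃ ω, p k = Sum.inl ω
  let J : Fin l → Finset ι := fun i => Finset.univ.filter fun k => ∃ t, p k = Sum.inr ⟨i, t⟩
  set P := ∑ k ∈ J₀, w k with hP
  -- If only constraints carried weight, the multiplier inequality would fail at the strict
  -- solution.
  have hP0 : 0 < P := by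
    refine (Finset.sum_nonneg fun k _ => hw k).lt_of_ne' fun h0 => ?_
    have h0' : ∀ k ∈ J₀, w k = 0 := (Finset.sum_eq_zero_iff_of_nonneg fun k _ => hw k).1 h0
    obtain ⟨ε, hε, h⟩ := hstrict
    obtain ⟨a, ha, hag, hab⟩ := h 0 (by simpa using hε.le)
    have h1 := hmult a ha
    rw [hab, inner_zero_right, add_zero] at h1
    have h2 : ∀ k, w k ≠ 0 → ψ (p k) + D (p k) (a - x) < 0 := fun k hk => by
      rcases hpk : p k with ω | ⟨i, t⟩
      · exact absurd (h0' k (Finset.mem_filter.2 ⟨Finset.mem_univ k, ω, hpk⟩)) hk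
      · exact hag i t
    obtain ⟨k₀, -, hk₀⟩ : ∃ k ∈ Finset.univ, w k ≠ 0 :=
      Finset.exists_ne_zero_of_sum_ne_zero (by rw [hw1]; exact one_ne_zero)
    refine h1.not_gt (Finset.sum_neg' (fun k _ => ?_) ⟨k₀, Finset.mem_univ _, ?_⟩)
    · by_cases hk : w k = 0
      · rw [hk, zero_mul]
      · exact mul_nonpos_of_nonneg_of_nonpos (hw k) (h2 k hk).le
    · exact mul_neg_of_pos_of_neg ((hw k₀).lt_of_ne' hk₀) (h2 k₀ hk₀)
  -- The arbitrary point is assigned only to objective indices, which belong to no `J i`.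
  let τ : ι → T := fun k => (p k).elim (fun _ => Classical.arbitrary T) fun q => q.2
  have hτ : ∀ i, ∀ k ∈ J i, p k = Sum.inr ⟨i, τ k⟩ := by
    intro i k hk
    obtain ⟨t, ht⟩ := (Finset.mem_filter.1 hk).2
    simp [τ, ht]
  have hcone : ∀ i, ∃ m ≤ d + 1, ∃ (t : Fin m → T) (c : Fin m → ℝ≥0), (∀ j, g i x (t j) = 0) ∧
      ∑ j, (c j : ℝ) • fderiv ℝ (fun x => g i x (t j)) x =
        ∑ k ∈ J i, (w k / P) • fderiv ℝ (fun x => g i x (τ k)) x := by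
    intro i
    have := exists_fin_of_sum_smul (J := J i) (w := fun k => w k / P)
      (fun k _ => div_nonneg (hw k) hP0.le) τ (fun t => fderiv ℝ (fun x => g i x t) x)
      (fun t => g i x t = 0) fun k hk hwk => by
        have h1 := hact k
        rw [hτ i k hk] at h1
        exact (mul_eq_zero.1 h1).resolve_left fun h => hwk (by rw [h, zero_div])
    rwa [finrank_strongDual_euclideanSpace] at this
  choose m hm t c hgt hsum using hcone
  choose μ hμ using fun i => exists_finiteMeasure_eq_sum_dirac (m i) (t i) (c i)
  obtain ⟨L, hL, hLh⟩ := exists_hasFDerivAt_semiInfMap hg hg_diff hg_grad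
    (hb.differentiable one_ne_zero) x
  refine ⟨μ, P⁻¹ • ν, ?_, fun i => ⟨m i, hm i, t i, c i, hμ i⟩⟩
  -- The functional `Θ` is an average of active objective gradients with total weight one, hence
  -- lies below Danskin's derivative.
  refine isLagrangeMultiplier_of_forall_nonneg hf hf_diff hf_grad hopt.1 hL
    (measureFunctional_mem_polarCone μ _) ?_ (∑ k ∈ J₀, (w k / P) • D (p k)) ?_ ?_
  · rw [measureFunctional_apply_of_eq_sum_dirac hμ]
    have h1 : ∀ i j, (c i j : ℝ) * (semiInfMap g hg b x).1 i (t i j) = 0 := fun i j => by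
      rw [show (semiInfMap g hg b x).1 i (t i j) = 0 from hgt i j, mul_zero]
    rw [show (semiInfMap g hg b x).2 = 0 from hxb]
    simp [h1]
  · intro h D' hD'
    have h1 : ∀ k ∈ J₀, w k / P * D (p k) h ≤ w k / P * D' := by
      intro k hk
      rcases eq_or_ne (w k) 0 with h0 | h0
      · simp [h0]
      · obtain ⟨ω, hω⟩ := (Finset.mem_filter.1 hk).2
        refine mul_le_mul_of_nonneg_left ?_ (div_nonneg (hw k) hP0.le)
        have h2 := (mul_eq_zero.1 (hact k)).resolve_left h0
        rw [hω] at h2 ⊢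
        exact hD' ω (sub_eq_zero.1 h2)
    simp only [sum_apply, smul_apply, smul_eq_mul]
    refine (Finset.sum_le_sum h1).trans_eq ?_
    rw [← Finset.sum_mul, ← Finset.sum_div, ← hP, div_self hP0.ne', one_mul]
  · intro a ha
    rw [measureFunctional_apply_of_eq_sum_dirac hμ]
    simp only [(hLh _).1, (hLh _).2, sum_apply, smul_apply, smul_eq_mul]
    have h1 : ∀ i, ∑ j, (c i j : ℝ) * fderiv ℝ (fun x => g i x (t i j)) x (a - x) =
        ∑ k ∈ J i, w k / P * D (p k) (a - x) := by
      intro i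
      have := congrArg (fun B : StrongDual ℝ (EuclideanSpace ℝ (Fin d)) => B (a - x)) (hsum i)
      simp only [sum_apply, smul_apply, smul_eq_mul] at this
      rw [this]
      refine Finset.sum_congr rfl fun k hk => ?_
      rw [hτ i k hk]
      rfl
    -- `J₀` and the sets `J i` partition the index set.
    have h2 : ∑ k ∈ J₀, w k / P * D (p k) (a - x) + ∑ i, ∑ k ∈ J i, w k / P * D (p k) (a - x) =
        ∑ k, w k / P * D (p k) (a - x) := by
      simp only [J₀, J, Finset.sum_filter]
      rw [Finset.sum_comm, ← Finset.sum_add_distrib]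
      refine Finset.sum_congr rfl fun k _ => ?_
      rcases hpk : p k with ω | ⟨i, t⟩
      · simp
      · simp [Sigma.ext_iff, Finset.sum_ite_eq]
    have h3 : 0 ≤ P⁻¹ * (∑ k, w k * D (p k) (a - x) + inner ℝ ν (fderiv ℝ b x (a - x))) :=
      mul_nonneg (inv_pos.2 hP0).le (hmult' a ha)
    simp only [h1]
    rw [← add_assoc, h2, real_inner_smul_left]
    rw [mul_add, Finset.mul_sum] at h3
    convert! h3 using 3 with k
    ring

end Existence

/-! ### Equal Lagrangians, and sufficiency under convexity. -/

section Transfer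

variable {E Y Y' : Type*} [NormedAddCommGroup E] [NormedSpace ℝ E]
  [NormedAddCommGroup Y] [NormedSpace ℝ Y] [NormedAddCommGroup Y'] [NormedSpace ℝ Y']

/-- Lagrange multipliers of two problems with the same Lagrangian. -/
theorem IsLagrangeMultiplier.congr {F : E → ℝ} {A : Set E} {G : E → Y} {K : Set Y} {G' : E → Y'}
    {K' : Set Y'} {x : E} {lam : StrongDual ℝ Y} {lam' : StrongDual ℝ Y'}
    (h : IsLagrangeMultiplier F A G K x lam) (hx : x ∈ feasibleRegion A G' K')
    (hpol : lam' ∈ polarCone K') (heq : ∀ z, lam' (G' z) = lam (G z)) :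
    IsLagrangeMultiplier F A G' K' x lam' := by
  obtain ⟨-, -, h0, hdir⟩ := h
  exact ⟨hx, hpol, (heq x).trans h0, by simpa only [heq] using hdir⟩

/-- For `0 < τ < 1`, convexity along the segment already bounds the difference quotient. -/
theorem _root_.ConvexOn.le_sub_of_hasDirDeriv {φ : E → ℝ} (hφ : ConvexOn ℝ univ φ) {x y : E} {D : ℝ}
    (hD : HasDirDeriv φ x (y - x) D) : D ≤ φ y - φ x := by
  refine le_of_tendsto hD ?_
  filter_upwards [eventually_mem_nhdsWithin,
    mem_nhdsWithin_of_mem_nhds (Iio_mem_nhds (zero_lt_one' ℝ))] with τ hτ hτ1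
  rw [div_le_iff₀ hτ]
  have := hφ.2 (mem_univ x) (mem_univ y) (sub_nonneg.2 (le_of_lt hτ1)) (le_of_lt hτ)
    (sub_add_cancel 1 τ)
  rw [show x + τ • (y - x) = (1 - τ) • x + τ • y by module]
  simp only [smul_eq_mul] at this
  linarith

/-- A feasible point with a Lagrange multiplier for which the Lagrangian is convex is globally
optimal. -/
theorem IsLagrangeMultiplier.isGloballyOptimal {F : E → ℝ} {A : Set E} {G : E → Y} {K : Set Y}
    {x : E} {lam : StrongDual ℝ Y} (h : IsLagrangeMultiplier F A G K x lam) (hA : Convex ℝ A)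
    (hconv : ConvexOn ℝ univ fun z => F z + lam (G z)) :
    IsGloballyOptimal F (feasibleRegion A G K) x := by
  obtain ⟨hx, hpol, h0, hdir⟩ := h
  refine ⟨hx, fun y hy => ?_⟩
  have hcone : y - x ∈ contingentCone A x := by
    refine ⟨fun n => 1 / ((n : ℝ) + 1), fun _ => y - x, fun n => Nat.one_div_pos_of_nat,
      tendsto_one_div_add_atTop_nhds_zero_nat, tendsto_const_nhds, fun n => ?_⟩
    exact hA.add_smul_sub_mem hx.1 hy.1 ⟨Nat.one_div_pos_of_nat.le,
      div_le_one_of_le₀ (by linarith [n.cast_nonneg (α := ℝ)]) (by positivity)⟩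
  obtain ⟨D, hD, hD0⟩ := hdir _ hcone
  have h1 := hconv.le_sub_of_hasDirDeriv hD
  have h2 := hpol _ hy.2
  simp only [h0] at h1
  change F x ≤ F y
  linarith

theorem convexOn_maxFun {W : Type*} [TopologicalSpace W] [CompactSpace W] [Nonempty W]
    {f : E → W → ℝ} (hf : Continuous fun p : E × W => f p.1 p.2)
    (hconv : ∀ ω, ConvexOn ℝ univ fun x => f x ω) : ConvexOn ℝ univ (maxFun f) := by
  refine ⟨convex_univ, fun x _ y _ r t hr ht hrt => ciSup_le fun ω => ?_⟩
  refine ((hconv ω).2 (mem_univ x) (mem_univ y) hr ht hrt).trans ?_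
  simp only [smul_eq_mul]
  gcongr <;> exact le_maxFun hf _ _

theorem convexOn_sum_mul {ι : Type*} (J : Finset ι) {c : ι → ℝ} (hc : ∀ k, 0 ≤ c k)
    {φ : ι → E → ℝ} (hφ : ∀ k, ConvexOn ℝ univ (φ k)) :
    ConvexOn ℝ univ fun z => ∑ k ∈ J, c k * φ k z := by
  refine ⟨convex_univ, fun x _ y _ r t hr ht hrt => ?_⟩
  simp only [smul_eq_mul, Finset.mul_sum, ← Finset.sum_add_distrib]
  refine Finset.sum_le_sum fun k _ => ?_
  have := mul_le_mul_of_nonneg_left ((hφ k).2 (mem_univ x) (mem_univ y) hr ht hrt) (hc k)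
  simp only [smul_eq_mul] at this
  linarith

end Transfer

/-! ### The polar of the finite-dimensional cone. -/

section DiscreteFunctionals

variable {J : Type*} [Fintype J] {s : ℕ}

/-- The functional `(y, z) ↦ ∑ p, c p * y p + ⟨ν, z⟩`. -/
noncomputable def discreteFunctional (c : J → ℝ) (ν : EuclideanSpace ℝ (Fin s)) :
    StrongDual ℝ ((J → ℝ) × EuclideanSpace ℝ (Fin s)) :=
  (∑ p, c p • (ContinuousLinearMap.proj p : (J → ℝ) →L[ℝ] ℝ)).comp
    (ContinuousLinearMap.fst ℝ (J → ℝ) (EuclideanSpace ℝ (Fin s))) +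
  (innerSL ℝ ν).comp (ContinuousLinearMap.snd ℝ (J → ℝ) (EuclideanSpace ℝ (Fin s)))

theorem discreteFunctional_apply (c : J → ℝ) (ν : EuclideanSpace ℝ (Fin s))
    (y : (J → ℝ) × EuclideanSpace ℝ (Fin s)) :
    discreteFunctional c ν y = ∑ p, c p * y.1 p + inner ℝ ν y.2 := by
  simp [discreteFunctional, sum_apply]

theorem discreteFunctional_mem_polarCone {c : J → ℝ} (hc : ∀ p, 0 ≤ c p)
    (ν : EuclideanSpace ℝ (Fin s)) : discreteFunctional c ν ∈ polarCone (discreteCone J s) := by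
  rintro y ⟨hy1, hy2⟩
  rw [discreteFunctional_apply, hy2, inner_zero_right, add_zero]
  exact Finset.sum_nonpos fun p _ => mul_nonpos_of_nonneg_of_nonpos (hc p) (hy1 p)

/-- The signs of the coefficients come from testing on minus the coordinate vectors, which lie in
the cone; `ν` is the Riesz representative on the second factor. -/
theorem exists_eq_discreteFunctional {lam : StrongDual ℝ ((J → ℝ) × EuclideanSpace ℝ (Fin s))}
    (hlam : lam ∈ polarCone (discreteCone J s)) :
    ∃ (c : J → ℝ≥0) (ν : EuclideanSpace ℝ (Fin s)),
      lam = discreteFunctional (fun p => (c p : ℝ)) ν := by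
  classical
  have hc : ∀ p, 0 ≤ lam (Pi.single p 1, 0) := fun p => by
    have h1 : lam (-(Pi.single p 1, 0)) ≤ 0 := hlam _ ⟨fun q => by
      by_cases h : q = p
      · subst h; simp
      · simp [h], by simp⟩
    rw [map_neg] at h1
    linarith
  refine ⟨fun p => ⟨lam (Pi.single p 1, 0), hc p⟩, (InnerProductSpace.toDual ℝ _).symm
    (lam.comp (ContinuousLinearMap.inr ℝ (J → ℝ) (EuclideanSpace ℝ (Fin s)))), ?_⟩
  refine ContinuousLinearMap.ext fun y => ?_
  have h1 : y = ∑ p, y.1 p • ((Pi.single p 1, 0) : (J → ℝ) × EuclideanSpace ℝ (Fin s)) +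
      (0, y.2) := by
    refine Prod.ext ?_ ?_
    · simp only [Prod.fst_add, Prod.fst_sum, Prod.smul_fst, add_zero]
      exact pi_eq_sum_univ' y.1
    · simp [Prod.snd_sum]
  rw [discreteFunctional_apply, InnerProductSpace.toDual_symm_apply]
  conv_lhs => rw [h1, map_add, map_sum]
  simp only [map_smul, smul_eq_mul]
  exact congrArg₂ _ (Finset.sum_congr rfl fun p _ => mul_comm _ _) rfl

end DiscreteFunctionals

/-! ### Passing between the semi-infinite and the discretised problems. -/

section Discretisation

variable {d s l : ℕ} {T : Type*} [MetricSpace T] [CompactSpace T]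
  {A : Set (EuclideanSpace ℝ (Fin d))} {F : EuclideanSpace ℝ (Fin d) → ℝ}
  {g : Fin l → EuclideanSpace ℝ (Fin d) → T → ℝ}
  {hg : ∀ i, Continuous fun p : EuclideanSpace ℝ (Fin d) × T => g i p.1 p.2}
  {b : EuclideanSpace ℝ (Fin d) → EuclideanSpace ℝ (Fin s)} {x : EuclideanSpace ℝ (Fin d)}

theorem mem_activeIndices_iff [Nonempty T]
    (hx : x ∈ feasibleRegion A (semiInfMap g hg b) (semiInfCone l s T)) (i : Fin l) :
    i ∈ activeIndices g x ↔ ∃ t, g i x t = 0 := by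
  have hle : ∀ t, g i x t ≤ 0 := hx.2.1 i
  have hmax : ∃ t, g i x t = ⨆ t, g i x t := exists_eq_maxFun (hg i) x
  simp only [activeIndices, Finset.mem_filter, Finset.mem_univ, true_and]
  constructor
  · rintro h
    obtain ⟨t, ht⟩ := hmax
    exact ⟨t, ht.trans h⟩
  · rintro ⟨t, ht⟩
    exact le_antisymm (ciSup_le hle) (ht ▸ le_maxFun (hg i) x t)

theorem mem_feasibleRegion_discreteMap
    (hx : x ∈ feasibleRegion A (semiInfMap g hg b) (semiInfCone l s T)) {I : Finset (Fin l)}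
    {m : I → ℕ} (t : ∀ i : I, Fin (m i) → T) :
    x ∈ feasibleRegion A (discreteMap g b t) (discreteCone _ s) :=
  ⟨hx.1, fun p => hx.2.1 p.1 (t p.1 p.2), hx.2.2⟩

/-- Lets data given only for active indices be extended by zero to all constraints. -/
theorem sum_dite_mem {ι : Type*} [Fintype ι] [DecidableEq ι] (I : Finset ι) (X : I → ℝ) :
    ∑ i, (if h : i ∈ I then X ⟨i, h⟩ else 0) = ∑ i : I, X i := by
  have h1 : ∀ i : I, X i = (fun i => if h : i ∈ I then X ⟨i, h⟩ else 0) (i : ι) := fun i => by simp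
  rw [Finset.sum_congr rfl fun i _ => h1 i,
    Finset.sum_coe_sort I fun i => if h : i ∈ I then X ⟨i, h⟩ else 0]
  refine (Finset.sum_subset (Finset.subset_univ I) fun i _ hi => ?_).symm
  simp [hi]

variable [MeasurableSpace T] [BorelSpace T]

/-- A discrete Lagrange multiplier of the semi-infinite problem yields a Lagrange multiplier of
a discretised problem. -/
theorem exists_isActiveDiscretisation_of_isDiscreteLagrangeMultiplier [Nonempty T]
    {μ : Fin l → FiniteMeasure T} {ν : EuclideanSpace ℝ (Fin s)} (h : IsDiscreteLagrangeMultiplier F A g hg b x μ ν) :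
    ∃ (m : activeIndices g x → ℕ) (t : ∀ i, Fin (m i) → T), IsActiveDiscretisation g x m t ∧
      ∃ lam, IsLagrangeMultiplier F A (discreteMap g b t) (discreteCone _ s) x lam := by
  classical
  obtain ⟨hlag, hdisc⟩ := h
  have hx := hlag.1
  have hle : ∀ i t, g i x t ≤ 0 := hx.2.1
  choose m hm t c hμ using hdisc
  have happ : ∀ z, measureFunctional μ ν (semiInfMap g hg b z) =
      ∑ i, ∑ j, (c i j : ℝ) * g i z (t i j) + inner ℝ ν (b z) := fun z =>
    measureFunctional_apply_of_eq_sum_dirac hμ ν _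
  have hcompl : ∀ i j, (c i j : ℝ) * g i x (t i j) = 0 := by
    have h1 := hlag.2.2.1
    rw [happ, show b x = 0 from hx.2.2, inner_zero_right, add_zero] at h1
    have h2 : ∀ i j, (c i j : ℝ) * g i x (t i j) ≤ 0 := fun i j =>
      mul_nonpos_of_nonneg_of_nonpos (c i j).2 (hle i _)
    intro i j
    have h3 := (Finset.sum_eq_zero_iff_of_nonpos fun i _ => Finset.sum_nonpos fun j _ => h2 i j).1
      h1 i (Finset.mem_univ i)
    exact (Finset.sum_eq_zero_iff_of_nonpos fun j _ => h2 i j).1 h3 j (Finset.mem_univ j)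
  have hinact : ∀ i, i ∉ activeIndices g x → ∀ j, (c i j : ℝ) = 0 := fun i hi j =>
    (mul_eq_zero.1 (hcompl i j)).resolve_right fun h0 =>
      hi ((mem_activeIndices_iff hx i).2 ⟨_, h0⟩)
  -- A discretisation needs at least one point for each active `i`, and only active points. An
  -- active `t₀` of weight zero fills an empty family and replaces atoms of weight zero, leaving
  -- every integral unchanged.
  have hact : ∀ i : activeIndices g x, ∃ (m' : ℕ) (_ : 1 ≤ m' ∧ m' ≤ d + 1) (t' : Fin m' → T)
      (c' : Fin m' → ℝ≥0), (∀ j, g i x (t' j) = 0) ∧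
        ∀ φ : T → ℝ, ∑ j, (c' j : ℝ) * φ (t' j) = ∑ j, (c i j : ℝ) * φ (t i j) := by
    intro i
    obtain ⟨t₀, ht₀⟩ := (mem_activeIndices_iff hx i).1 i.2
    rcases Nat.eq_zero_or_pos (m i) with h0 | h0
    · refine ⟨1, ⟨le_rfl, by omega⟩, fun _ => t₀, fun _ => 0, fun _ => ht₀, fun φ => ?_⟩
      have : IsEmpty (Fin (m i)) := h0 ▸ Fin.isEmpty
      simp
    · refine ⟨m i, ⟨h0, hm i⟩, fun j => if c i j = 0 then t₀ else t i j, c i, fun j => ?_,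
        fun φ => Finset.sum_congr rfl fun j _ => ?_⟩
      · by_cases hc : c i j = 0
        · simpa [hc] using ht₀
        · simpa [hc] using (mul_eq_zero.1 (hcompl i j)).resolve_left (NNReal.coe_ne_zero.2 hc)
      · by_cases hc : c i j = 0 <;> simp [hc]
  choose m' hm' t' c' ht' hsum using hact
  have hact : IsActiveDiscretisation g x m' t' := ⟨hm', ht'⟩
  have hfeas : x ∈ feasibleRegion A (discreteMap g b t') (discreteCone _ s) :=
    mem_feasibleRegion_discreteMap hx t'
  have hpol := discreteFunctional_mem_polarCone (s := s)
    (c := fun p : (i : activeIndices g x) × Fin (m' i) => (c' p.1 p.2 : ℝ))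
    (fun p => (c' p.1 p.2).2) ν
  refine ⟨m', t', hact, _, hlag.congr hfeas hpol fun z => ?_⟩
  rw [discreteFunctional_apply, happ, Fintype.sum_sigma]
  congr 1
  refine (Finset.sum_congr rfl fun i _ => hsum i (g i z)).trans ?_
  rw [← sum_dite_mem (activeIndices g x) fun i => ∑ j, (c i j : ℝ) * g i z (t i j)]
  refine Finset.sum_congr rfl fun i _ => ?_
  split_ifs with hi
  · rfl
  · simp [hinact i hi]

/-- A Lagrange multiplier of a discretised problem yields a discrete Lagrange multiplier of the
semi-infinite problem. -/
theorem exists_isDiscreteLagrangeMultiplier_of_isLagrangeMultiplier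
    (hx : x ∈ feasibleRegion A (semiInfMap g hg b) (semiInfCone l s T))
    {m : activeIndices g x → ℕ} {t : ∀ i, Fin (m i) → T} (ht : IsActiveDiscretisation g x m t)
    {lam : StrongDual ℝ (((Σ i, Fin (m i)) → ℝ) × EuclideanSpace ℝ (Fin s))}
    (hlag : IsLagrangeMultiplier F A (discreteMap g b t) (discreteCone _ s) x lam) :
    ∃ μ ν, IsDiscreteLagrangeMultiplier F A g hg b x μ ν := by
  classical
  obtain ⟨c, ν, rfl⟩ := exists_eq_discreteFunctional hlag.2.1
  have hex : ∀ i, ∃ m' ≤ d + 1, ∃ (t' : Fin m' → T) (c' : Fin m' → ℝ≥0), ∀ φ : T → ℝ,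
      ∑ j, (c' j : ℝ) * φ (t' j) =
        if h : i ∈ activeIndices g x then ∑ j, (c ⟨⟨i, h⟩, j⟩ : ℝ) * φ (t ⟨i, h⟩ j) else 0 := by
    intro i
    by_cases h : i ∈ activeIndices g x
    · exact ⟨m ⟨i, h⟩, (ht.1 _).2, t ⟨i, h⟩, fun j => c ⟨⟨i, h⟩, j⟩, fun φ => by simp [h]⟩
    · exact ⟨0, zero_le, Fin.elim0, Fin.elim0, fun φ => by simp [h]⟩
  choose m' hm' t' c' hsum using hex
  choose μ hμ using fun i => exists_finiteMeasure_eq_sum_dirac (m' i) (t' i) (c' i)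
  refine ⟨μ, ν, hlag.congr hx (measureFunctional_mem_polarCone μ ν) fun z => ?_,
    fun i => ⟨m' i, hm' i, t' i, c' i, hμ i⟩⟩
  rw [discreteFunctional_apply, measureFunctional_apply_of_eq_sum_dirac hμ, Fintype.sum_sigma]
  congr 1
  refine (Finset.sum_congr rfl fun i _ => hsum i (g i z)).trans ?_
  exact sum_dite_mem (activeIndices g x) fun i => ∑ j, (c ⟨i, j⟩ : ℝ) * g i z (t i j)

end Discretisation

/-! ### The convex problem and Slater's condition. -/

section ConvexCase

variable {d s l : ℕ} {W : Type*} [TopologicalSpace W] [CompactSpace W] [Nonempty W]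
  {T : Type*}
  {A : Set (EuclideanSpace ℝ (Fin d))} {f : EuclideanSpace ℝ (Fin d) → W → ℝ}
  {g : Fin l → EuclideanSpace ℝ (Fin d) → T → ℝ}
  {b : EuclideanSpace ℝ (Fin d) → EuclideanSpace ℝ (Fin s)} {x : EuclideanSpace ℝ (Fin d)}

theorem isGloballyOptimal_of_isLagrangeMultiplier_discreteMap {I : Finset (Fin l)} {m : I → ℕ}
    {t : ∀ i : I, Fin (m i) → T}
    {lam : StrongDual ℝ (((Σ i : I, Fin (m i)) → ℝ) × EuclideanSpace ℝ (Fin s))}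
    (h : IsLagrangeMultiplier (maxFun f) A (discreteMap g b t) (discreteCone _ s) x lam)
    (hA : Convex ℝ A)
    (hf : Continuous fun p : EuclideanSpace ℝ (Fin d) × W => f p.1 p.2) (hb : ∀ x, b x = 0)
    (hfc : ∀ ω, ConvexOn ℝ univ fun x => f x ω) (hgc : ∀ i t, ConvexOn ℝ univ fun x => g i x t) :
    IsGloballyOptimal (maxFun f) (feasibleRegion A (discreteMap g b t) (discreteCone _ s)) x := by
  refine h.isGloballyOptimal hA ((convexOn_maxFun hf hfc).add ?_)
  obtain ⟨c, ν, rfl⟩ := exists_eq_discreteFunctional h.2.1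
  have happ : ∀ z, discreteFunctional (fun p => (c p : ℝ)) ν (discreteMap g b t z) =
      ∑ p : Σ i : I, Fin (m i), (c p : ℝ) * g p.1 z (t p.1 p.2) := fun z => by
    rw [discreteFunctional_apply, show (discreteMap g b t z).2 = 0 from hb z, inner_zero_right,
      add_zero]
    rfl
  simp only [happ]
  exact convexOn_sum_mul _ (fun p => (c p).2) fun p => hgc p.1 (t p.1 p.2)

variable [MetricSpace T] [CompactSpace T]
  {hg : ∀ i, Continuous fun p : EuclideanSpace ℝ (Fin d) × T => g i p.1 p.2}

/-- With `b = 0` the `ν` term disappears, and the Lagrangian is `F` plus a nonnegative combination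
of the convex functions `g i · t`. -/
theorem IsDiscreteLagrangeMultiplier.isGloballyOptimal [MeasurableSpace T] [BorelSpace T]
    {μ : Fin l → FiniteMeasure T} {ν : EuclideanSpace ℝ (Fin s)}
    (h : IsDiscreteLagrangeMultiplier (maxFun f) A g hg b x μ ν) (hA : Convex ℝ A)
    (hf : Continuous fun p : EuclideanSpace ℝ (Fin d) × W => f p.1 p.2) (hb : ∀ x, b x = 0)
    (hfc : ∀ ω, ConvexOn ℝ univ fun x => f x ω) (hgc : ∀ i t, ConvexOn ℝ univ fun x => g i x t) :
    IsGloballyOptimal (maxFun f)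
      (feasibleRegion A (semiInfMap g hg b) (semiInfCone l s T)) x := by
  obtain ⟨hlag, hdisc⟩ := h
  refine hlag.isGloballyOptimal hA ((convexOn_maxFun hf hfc).add ?_)
  choose m hm t c hμ using hdisc
  have happ : ∀ z, measureFunctional μ ν (semiInfMap g hg b z) =
      ∑ p : (i : Fin l) × Fin (m i), (c p.1 p.2 : ℝ) * g p.1 z (t p.1 p.2) := fun z => by
    rw [measureFunctional_apply_of_eq_sum_dirac hμ, Fintype.sum_sigma,
      show (semiInfMap g hg b z).2 = 0 from hb z, inner_zero_right, add_zero]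
    rfl
  simp only [happ]
  exact convexOn_sum_mul (Finset.univ : Finset ((i : Fin l) × Fin (m i)))
    (c := fun p => (c p.1 p.2 : ℝ)) (fun p => (c p.1 p.2).2) fun p => hgc p.1 (t p.1 p.2)

/-- Under Slater's condition a globally optimal solution of the convex problem has a discrete
Lagrange multiplier. -/
theorem exists_isDiscreteLagrangeMultiplier_of_slater [Nonempty T] [MeasurableSpace T]
    [BorelSpace T] (hA : Convex ℝ A)
    (hf : Continuous fun p : EuclideanSpace ℝ (Fin d) × W => f p.1 p.2)
    (hf_diff : ∀ ω, Differentiable ℝ fun x => f x ω)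
    (hf_grad : Continuous fun p : EuclideanSpace ℝ (Fin d) × W =>
      fderiv ℝ (fun x => f x p.2) p.1)
    (hg_diff : ∀ i t, Differentiable ℝ fun x => g i x t)
    (hg_grad : ∀ i, Continuous fun p : EuclideanSpace ℝ (Fin d) × T =>
      fderiv ℝ (fun x => g i x p.2) p.1)
    (hb : ∀ x, b x = 0) (hgc : ∀ i t, ConvexOn ℝ univ fun x => g i x t)
    (hslater : ∃ x₀ ∈ A, ∀ i t, g i x₀ t < 0)
    (hopt : IsGloballyOptimal (maxFun f)
      (feasibleRegion A (semiInfMap g hg b) (semiInfCone l s T)) x) :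
    ∃ μ ν, IsDiscreteLagrangeMultiplier (maxFun f) A g hg b x μ ν := by
  -- The existence theorem asks that every small `z` be attained by the linearised equality,
  -- impossible for a zero map into `ℝ^s` with `s > 0`. The vacuous equality is therefore replaced
  -- by one in `ℝ^0`, and `ν = 0` serves afterwards.
  let b₀ : EuclideanSpace ℝ (Fin d) → EuclideanSpace ℝ (Fin 0) := fun _ => 0
  have hreg : feasibleRegion A (semiInfMap g hg b₀) (semiInfCone l 0 T) =
      feasibleRegion A (semiInfMap g hg b) (semiInfCone l s T) := by
    ext z
    exact ⟨fun hz => ⟨hz.1, hz.2.1, hb z⟩, fun hz => ⟨hz.1, hz.2.1, rfl⟩⟩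
  obtain ⟨x₀, hx₀, hneg⟩ := hslater
  obtain ⟨μ, ν, hlag, hdisc⟩ := exists_isDiscreteLagrangeMultiplier_of_isLocallyOptimal (b := b₀)
    hA hf hf_diff hf_grad hg hg_diff hg_grad contDiff_const
    (by rw [hreg]; exact ⟨hopt.1, hopt.2.localize⟩)
    -- By the gradient inequality, the linearisation at `x` evaluated at the Slater point is at most
    -- `g i x₀ t < 0`.
    ⟨1, one_pos, fun z _ => ⟨x₀, hx₀, fun i t => by
      have := (hgc i t).le_sub_of_hasDirDeriv ((hg_diff i t x).hasFDerivAt.hasDirDeriv (x₀ - x))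
      linarith [hneg i t], Subsingleton.elim _ _⟩⟩
  refine ⟨μ, 0, hlag.congr hopt.1 (measureFunctional_mem_polarCone μ 0) fun z => ?_, hdisc⟩
  rw [measureFunctional_apply, measureFunctional_apply, inner_zero_left,
    show (semiInfMap g hg b₀ z).2 = 0 from rfl, inner_zero_right]
  rfl

end ConvexCase

end ConeMinimax

/-! ### The main theorem. -/

open ConeMinimax in
theorem mainTheorem9 {d s l : ℕ}
    {W : Type*} [TopologicalSpace W] [CompactSpace W] [T2Space W] [Nonempty W]
    {T : Type*} [MetricSpace T] [CompactSpace T] [Nonempty T] [MeasurableSpace T] [BorelSpace T]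
    -- the data of the problem
    (A : Set (EuclideanSpace ℝ (Fin d))) (hAclosed : IsClosed A) (hAconvex : Convex ℝ A)
    (f : EuclideanSpace ℝ (Fin d) → W → ℝ)
    (hf : Continuous fun p : EuclideanSpace ℝ (Fin d) × W => f p.1 p.2)
    (hf_diff : ∀ ω, Differentiable ℝ fun x => f x ω)
    (hf_grad : Continuous fun p : EuclideanSpace ℝ (Fin d) × W =>
      fderiv ℝ (fun x => f x p.2) p.1)
    (g : Fin l → EuclideanSpace ℝ (Fin d) → T → ℝ)
    (hg : ∀ i, Continuous fun p : EuclideanSpace ℝ (Fin d) × T => g i p.1 p.2)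
    (hg_diff : ∀ i t, Differentiable ℝ fun x => g i x t)
    (hg_grad : ∀ i, Continuous fun p : EuclideanSpace ℝ (Fin d) × T =>
      fderiv ℝ (fun x => g i x p.2) p.1)
    (b : EuclideanSpace ℝ (Fin d) → EuclideanSpace ℝ (Fin s)) (hb : ContDiff ℝ 1 b)
    -- a feasible point
    (xs : EuclideanSpace ℝ (Fin d))
    (hxs : xs ∈ feasibleRegion A (semiInfMap g hg b) (semiInfCone l s T)) :
    -- existence of a discrete Lagrange multiplier at a locally optimal solution
    (IsLocallyOptimal (maxFun f) (feasibleRegion A (semiInfMap g hg b) (semiInfCone l s T)) xs →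
      RobinsonCQ A (semiInfMap g hg b) (semiInfCone l s T) xs →
      ∃ μ ν, IsDiscreteLagrangeMultiplier (maxFun f) A g hg b xs μ ν) ∧
    -- discrete Lagrange multipliers and multipliers of discretised problems
    ((∃ μ ν, IsDiscreteLagrangeMultiplier (maxFun f) A g hg b xs μ ν) ↔
      ∃ (m : activeIndices g xs → ℕ) (t : ∀ i, Fin (m i) → T),
        IsActiveDiscretisation g xs m t ∧
        ∃ lam, IsLagrangeMultiplier (maxFun f) A (discreteMap g b t) (discreteCone _ s) xs lam) ∧
    -- the convex case
    ((∀ x, b x = 0) → (∀ ω, ConvexOn ℝ univ fun x => f x ω) →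
      (∀ i t, ConvexOn ℝ univ fun x => g i x t) →
      (∃ x₀ ∈ A, ∀ i t, g i x₀ t < 0) →
      ((∃ μ ν, IsDiscreteLagrangeMultiplier (maxFun f) A g hg b xs μ ν) ↔
        IsGloballyOptimal (maxFun f)
          (feasibleRegion A (semiInfMap g hg b) (semiInfCone l s T)) xs) ∧
      (IsGloballyOptimal (maxFun f)
          (feasibleRegion A (semiInfMap g hg b) (semiInfCone l s T)) xs ↔
        ∃ (m : activeIndices g xs → ℕ) (t : ∀ i, Fin (m i) → T),
          IsActiveDiscretisation g xs m t ∧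
          IsGloballyOptimal (maxFun f)
            (feasibleRegion A (discreteMap g b t) (discreteCone _ s)) xs)) := by
  have hb1 : Differentiable ℝ b := hb.differentiable one_ne_zero
  have hiff : (∃ μ ν, IsDiscreteLagrangeMultiplier (maxFun f) A g hg b xs μ ν) ↔
      ∃ (m : activeIndices g xs → ℕ) (t : ∀ i, Fin (m i) → T),
        IsActiveDiscretisation g xs m t ∧
        ∃ lam, IsLagrangeMultiplier (maxFun f) A (discreteMap g b t) (discreteCone _ s) xs lam := by
    constructor
    · rintro ⟨μ, ν, h⟩
      exact exists_isActiveDiscretisation_of_isDiscreteLagrangeMultiplier h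
    · rintro ⟨m, t, ht, lam, h⟩
      exact exists_isDiscreteLagrangeMultiplier_of_isLagrangeMultiplier hxs ht h
  refine ⟨fun hopt hR => ?_, hiff, fun hb0 hfc hgc hslater => ?_⟩
  · exact exists_isDiscreteLagrangeMultiplier_of_isLocallyOptimal hAconvex hf hf_diff hf_grad hg
      hg_diff hg_grad hb hopt (hR.exists_strict hg_diff hg_grad hb1 hxs.2.2)
  · have hslat := exists_isDiscreteLagrangeMultiplier_of_slater (hg := hg) (x := xs) hAconvex hf
      hf_diff hf_grad hg_diff hg_grad hb0 hgc hslater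
    refine ⟨⟨?_, hslat⟩, fun h => ?_, ?_⟩
    · rintro ⟨μ, ν, h⟩
      exact h.isGloballyOptimal hAconvex hf hb0 hfc hgc
    · obtain ⟨m, t, ht, lam, hlam⟩ := hiff.1 (hslat h)
      exact ⟨m, t, ht,
        isGloballyOptimal_of_isLagrangeMultiplier_discreteMap hlam hAconvex hf hb0 hfc hgc⟩
    · rintro ⟨m, t, -, h⟩
      -- The region of the discretised problem contains that of the semi-infinite one, so no
      -- multiplier is needed here.
      exact ⟨hxs, fun y hy => h.2 (mem_feasibleRegion_discreteMap hy t)⟩
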